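/- Let $n\ge 0$ and $0<\alpha<1$. Let $\Theta$ be a real antisymmetric $n\times n$ matrix with strictly lower triangular part $\Theta_\downarrow$, and put $\chi(k_1,k_2)=e^{2\pi i\langle k_1,\Theta_\downarrow k_2\rangle}$ for $k_1,k_2\in\mathbf Z^n$. The quantum torus $\mathcal A_\Theta$ is the von Neumann algebra on $\ell^2(\mathbf Z^n)$ generated by the unitaries $(u_kf)(\ell)=\chi(k,-\ell)f(\ell-k)$, $k\in\mathbf Z^n$. Let $\|\cdot\|_\infty$ be its operator norm, and let $\sigma:\mathbf T^n\to\mathrm{Aut}(\mathcal A_\Theta)$, $\mathbf T^n=\mathbf R^n/\mathbf Z^n$, be the action by normal $*$-automorphisms with $\sigma_z(u_k)=e^{2\pi i\langle z,k\rangle}u_k$. For $t,s>0$ let $$h_t(z)=\sum_{k\in\mathbf Z^n}e^{-4\pi^2|k|^2t}e^{2\pi i\langle k,z\rangle},\qquad p_s(z)=\sum_{k\in\mathbf Z^n}e^{-2\pi|k|s}e^{2\pi i\langle k,z\rangle}$$ be the heat and Poisson kernels of $\mathbf T^n$. Let $$T_tf=\int_{\mathbf T^n}h_t(z)\,\sigma_z(f)\,dz,\qquad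 P_sf=\int_{\mathbf T^n}p_s(z)\,\sigma_z(f)\,dz$$ be the transferred heat semigroup $\mathcal T=(T_t)$ on $\mathcal A_\Theta$ and its associated Poisson semigroup $(P_s)$, where $dz$ is the normalized Haar measure and the integrals are taken in the strong operator topology. For $f\in\mathcal A_\Theta$ define, with values in $[0,\infty]$, $$\|f\|_{\Lambda_\alpha(\mathcal T)}=\max\Big\{\|f\|_\infty,\ \sup_{s>0}\Big\|s^{1-\alpha}\frac{d}{ds}P_s f\Big\|_\infty\Big\},\qquad \|f\|_\alpha=\max\Big\{\|f\|_\infty,\ \sup_{0\ne z\in\mathbf T^n}\frac{\|\sigma_z(f)-f\|_\infty}{|z|^\alpha}\Big\},$$ where $|z|$ is the Euclidean distance from $z$ to $0$ in $\mathbf R^n/\mathbf Z^n$. Let $\Lambda_\alpha(\mathcal T)$ and $\mathrm{Lip}_\alpha(\mathcal A_\Theta)$ be the subspaces of $\mathcal A_\Theta$ on which $\|\cdot\|_{\Lambda_\alpha(\mathcal T)}$, respectively $\|\cdot\|_\alpha$, is finite. Then there is a constant $C=C(n,\alpha)\in(0,\infty)$, independent of $\Theta$, such that for all $f\in\mathcal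 A_\Theta$ $$\|f\|_{\Lambda_\alpha(\mathcal T)}\le C\,\|f\|_\alpha\quad\text{and}\quad \|f\|_\alpha\le C\,\|f\|_{\Lambda_\alpha(\mathcal T)}.$$ Consequently $\Lambda_\alpha(\mathcal T)=\mathrm{Lip}_\alpha(\mathcal A_\Theta)$ as linear spaces, and the identity map is a linear isomorphism between them that is bounded in both directions, with constant $C$, for the two norms. -/

import Mathlib

open MeasureTheory
open scoped ENNReal NNReal

noncomputable section

namespace QTorus

/-- The Hilbert space `ℓ²(ℤⁿ)`. -/
abbrev Hil (n : ℕ) : Type := lp (fun _ : Fin n → ℤ => ℂ) 2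

/-- The isometry `f ↦ (l ↦ c l * f (e l))` of `ℓ²(ι)`, for a permutation `e` of `ι` and
unimodular weights `c`. -/
def weightedPerm {ι : Type} (e : ι ≃ ι) (c : ι → ℂ) (hc : ∀ i, ‖c i‖ = 1) :
    lp (fun _ : ι => ℂ) 2 →ₗᵢ[ℂ] lp (fun _ : ι => ℂ) 2 where
  toFun f := ⟨fun l => c l * f (e l), by
    have h := (lp.memℓp f).summable (by norm_num)
    refine memℓp_gen ?_
    have h2 := e.summable_iff.mpr h
    refine h2.congr fun l => ?_
    simp [hc]⟩
  map_add' f g := by ext l; exact mul_add _ _ _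
  map_smul' a f := by ext l; simp; ring
  norm_map' f := by
    have h2 : (0 : ℝ) < (2 : ℝ≥0∞).toReal := by norm_num
    rw [lp.norm_eq_tsum_rpow h2, lp.norm_eq_tsum_rpow h2]
    congr 1
    rw [← e.tsum_eq (fun i => ‖f i‖ ^ (2 : ℝ≥0∞).toReal)]
    refine tsum_congr fun l => ?_
    simp [hc]

section Algebra

variable {n : ℕ}

/-- The strictly lower triangular part of a matrix. -/
def lowerPart (Θ : Matrix (Fin n) (Fin n) ℝ) : Matrix (Fin n) (Fin n) ℝ :=
  Matrix.of fun i j => if j < i then Θ i j else 0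

/-- The bicharacter `χ(k₁, k₂) = exp(2πi ⟨k₁, Θ↓ k₂⟩)` on `ℤⁿ`. -/
def bichar (Θ : Matrix (Fin n) (Fin n) ℝ) (k₁ k₂ : Fin n → ℤ) : ℂ :=
  Complex.exp (2 * Real.pi * Complex.I *
    (((fun i => (k₁ i : ℝ)) ⬝ᵥ Matrix.mulVec (lowerPart Θ) (fun i => (k₂ i : ℝ)) : ℝ) : ℂ))

lemma norm_bichar (Θ : Matrix (Fin n) (Fin n) ℝ) (k₁ k₂ : Fin n → ℤ) :
    ‖bichar Θ k₁ k₂‖ = 1 := by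
  unfold bichar
  generalize ((fun i => (k₁ i : ℝ)) ⬝ᵥ Matrix.mulVec (lowerPart Θ) (fun i => (k₂ i : ℝ))) = r
  rw [← Complex.norm_exp_ofReal_mul_I (2 * Real.pi * r)]
  push_cast
  congr 2
  ring

/-- The unitary `u_k` on `ℓ²(ℤⁿ)`, `(u_k f)(l) = χ(k, -l) f(l - k)`. -/
def unitaryGen (Θ : Matrix (Fin n) (Fin n) ℝ) (k : Fin n → ℤ) : Hil n →L[ℂ] Hil n :=
  (weightedPerm (Equiv.subRight k) (fun l => bichar Θ k (-l))
    (fun _ => norm_bichar Θ _ _)).toContinuousLinearMap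

lemma unitaryGen_apply (Θ : Matrix (Fin n) (Fin n) ℝ) (k : Fin n → ℤ) (f : Hil n)
    (l : Fin n → ℤ) : unitaryGen Θ k f l = bichar Θ k (-l) * f (l - k) := rfl

/-- The quantum torus `A_Θ`: the von Neumann algebra generated by the `u_k`, that is, the double
commutant of this family of operators and their adjoints. -/
def quantumTorus (Θ : Matrix (Fin n) (Fin n) ℝ) : VonNeumannAlgebra (Hil n) where
  toStarSubalgebra :=
    StarSubalgebra.centralizer ℂ
      (StarSubalgebra.centralizer ℂ (Set.range (unitaryGen Θ)) : Set (Hil n →L[ℂ] Hil n))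
  centralizer_centralizer' := by
    change Set.centralizer (Set.centralizer ((StarSubalgebra.centralizer ℂ
      (StarSubalgebra.centralizer ℂ (Set.range (unitaryGen Θ)) : Set (Hil n →L[ℂ] Hil n)) :
        Set (Hil n →L[ℂ] Hil n)))) = _
    rw [StarSubalgebra.coe_centralizer_centralizer, Set.centralizer_centralizer_centralizer]
    exact (StarSubalgebra.coe_centralizer_centralizer ℂ (Set.range (unitaryGen Θ))).symm

/-- `A_Θ` as a type, with the operator norm. -/
abbrev QT (Θ : Matrix (Fin n) (Fin n) ℝ) : Type := (quantumTorus Θ).toStarSubalgebra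

lemma mem_quantumTorus (Θ : Matrix (Fin n) (Fin n) ℝ) (x : Hil n →L[ℂ] Hil n) :
    x ∈ (quantumTorus Θ).toStarSubalgebra ↔
      ∀ y ∈ StarSubalgebra.centralizer ℂ (Set.range (unitaryGen Θ)),
        y * x = x * y ∧ star y * x = x * star y :=
  StarSubalgebra.mem_centralizer_iff ℂ

lemma unitaryGen_mem (Θ : Matrix (Fin n) (Fin n) ℝ) (k : Fin n → ℤ) :
    unitaryGen Θ k ∈ (quantumTorus Θ).toStarSubalgebra := by
  rw [mem_quantumTorus]
  intro y hy
  have h1 := fun y (hy : y ∈ StarSubalgebra.centralizer ℂ (Set.range (unitaryGen Θ))) =>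
    ((StarSubalgebra.mem_centralizer_iff ℂ).1 hy _ ⟨k, rfl⟩).1.symm
  exact ⟨h1 y hy, h1 _ (star_mem hy)⟩

/-- `u_k` as an element of `A_Θ`. -/
def gen (Θ : Matrix (Fin n) (Fin n) ℝ) (k : Fin n → ℤ) : QT Θ :=
  ⟨unitaryGen Θ k, unitaryGen_mem Θ k⟩

end Algebra

section Action

variable {n : ℕ}

open UnitAddTorus (mFourier)

lemma norm_mFourier_apply (k : Fin n → ℤ) (z : UnitAddTorus (Fin n)) :
    ‖mFourier k z‖ = 1 := by
  simp only [mFourier, fourier_apply, ContinuousMap.coe_mk, norm_prod, Circle.norm_coe,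
    Finset.prod_const_one]

lemma mFourier_apply_add (k : Fin n → ℤ) (z w : UnitAddTorus (Fin n)) :
    mFourier k (z + w) = mFourier k z * mFourier k w := by
  simp only [mFourier, ContinuousMap.coe_mk, Pi.add_apply, ← Finset.prod_mul_distrib]
  refine Finset.prod_congr rfl fun i _ => ?_
  simp [fourier_apply, AddCircle.toCircle_add]

lemma mFourier_apply_zero (k : Fin n → ℤ) : mFourier k (0 : UnitAddTorus (Fin n)) = 1 := by
  simp [mFourier]

lemma mFourier_apply_neg (k : Fin n → ℤ) (z : UnitAddTorus (Fin n)) :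
    mFourier k (-z) = (starRingEnd ℂ) (mFourier k z) := by
  rw [← UnitAddTorus.mFourier_neg]
  simp [mFourier, fourier_apply]

/-- The diagonal unitary `(V_z f)(l) = exp(2πi ⟨z, l⟩) f(l)` on `ℓ²(ℤⁿ)`, which implements the
translation by `z ∈ 𝕋ⁿ`. -/
def diagUnitary (z : UnitAddTorus (Fin n)) : Hil n →L[ℂ] Hil n :=
  (weightedPerm (Equiv.refl _) (fun l => mFourier l z)
    (fun l => norm_mFourier_apply l z)).toContinuousLinearMap

lemma diagUnitary_apply (z : UnitAddTorus (Fin n)) (f : Hil n) (l : Fin n → ℤ) :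
    diagUnitary z f l = mFourier l z * f l := rfl

lemma norm_diagUnitary_apply (z : UnitAddTorus (Fin n)) (f : Hil n) :
    ‖diagUnitary z f‖ = ‖f‖ := LinearIsometry.norm_map _ f

lemma diagUnitary_add (z w : UnitAddTorus (Fin n)) :
    diagUnitary (z + w) = diagUnitary z * diagUnitary w := by
  ext f l
  change mFourier l (z + w) * f l = mFourier l z * (mFourier l w * f l)
  rw [mFourier_apply_add, mul_assoc]

lemma diagUnitary_zero : diagUnitary (0 : UnitAddTorus (Fin n)) = 1 := by
  ext f l
  change mFourier l 0 * f l = f l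
  rw [mFourier_apply_zero, one_mul]

lemma diagUnitary_mul_neg (z : UnitAddTorus (Fin n)) :
    diagUnitary z * diagUnitary (-z) = 1 := by
  rw [← diagUnitary_add, add_neg_cancel, diagUnitary_zero]

lemma diagUnitary_neg_mul (z : UnitAddTorus (Fin n)) :
    diagUnitary (-z) * diagUnitary z = 1 := by
  rw [← diagUnitary_add, neg_add_cancel, diagUnitary_zero]

lemma star_diagUnitary (z : UnitAddTorus (Fin n)) : star (diagUnitary z) = diagUnitary (-z) := by
  symm
  rw [ContinuousLinearMap.star_eq_adjoint, ContinuousLinearMap.eq_adjoint_iff]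
  intro f g
  rw [lp.inner_eq_tsum, lp.inner_eq_tsum]
  refine tsum_congr fun l => ?_
  rw [diagUnitary_apply, diagUnitary_apply, mFourier_apply_neg]
  simp only [RCLike.inner_apply, map_mul, RingHomCompTriple.comp_apply, RingHom.id_apply]
  ring

lemma diagUnitary_mul_unitaryGen (Θ : Matrix (Fin n) (Fin n) ℝ) (k : Fin n → ℤ)
    (z : UnitAddTorus (Fin n)) :
    diagUnitary z * unitaryGen Θ k = mFourier k z • (unitaryGen Θ k * diagUnitary z) := by
  ext f l
  change mFourier l z * (bichar Θ k (-l) * f (l - k)) =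
    mFourier k z * (bichar Θ k (-l) * (mFourier (l - k) z * f (l - k)))
  have : mFourier l z = mFourier k z * mFourier (l - k) z := by
    rw [← UnitAddTorus.mFourier_add, add_sub_cancel]
  rw [this]
  ring

/-- Conjugation `V_z x V_z^*` of an operator on `ℓ²(ℤⁿ)`. -/
def conjOp (z : UnitAddTorus (Fin n)) (x : Hil n →L[ℂ] Hil n) : Hil n →L[ℂ] Hil n :=
  diagUnitary z * x * diagUnitary (-z)

lemma conjOp_mul (z : UnitAddTorus (Fin n)) (x y : Hil n →L[ℂ] Hil n) :
    conjOp z (x * y) = conjOp z x * conjOp z y := by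
  unfold conjOp
  calc _ = diagUnitary z * x * 1 * y * diagUnitary (-z) := by simp only [mul_assoc, one_mul]
    _ = _ := by rw [← diagUnitary_neg_mul z]; simp only [mul_assoc]

lemma conjOp_star (z : UnitAddTorus (Fin n)) (x : Hil n →L[ℂ] Hil n) :
    conjOp z (star x) = star (conjOp z x) := by
  simp only [conjOp, star_mul, star_diagUnitary, neg_neg, mul_assoc]

lemma conjOp_conjOp (z w : UnitAddTorus (Fin n)) (x : Hil n →L[ℂ] Hil n) :
    conjOp z (conjOp w x) = conjOp (z + w) x := by
  simp only [conjOp, diagUnitary_add, mul_assoc, neg_add_rev]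

lemma conjOp_zero (x : Hil n →L[ℂ] Hil n) : conjOp 0 x = x := by
  simp [conjOp, diagUnitary_zero]

lemma conjOp_unitaryGen (Θ : Matrix (Fin n) (Fin n) ℝ) (k : Fin n → ℤ)
    (z : UnitAddTorus (Fin n)) : conjOp z (unitaryGen Θ k) = mFourier k z • unitaryGen Θ k := by
  rw [conjOp, diagUnitary_mul_unitaryGen, smul_mul_assoc, mul_assoc, diagUnitary_mul_neg, mul_one]

lemma conjOp_mem_commutant (Θ : Matrix (Fin n) (Fin n) ℝ) (z : UnitAddTorus (Fin n))
    {y : Hil n →L[ℂ] Hil n} (hy : y ∈ StarSubalgebra.centralizer ℂ (Set.range (unitaryGen Θ))) :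
    conjOp z y ∈ StarSubalgebra.centralizer ℂ (Set.range (unitaryGen Θ)) := by
  have key : ∀ y ∈ StarSubalgebra.centralizer ℂ (Set.range (unitaryGen Θ)), ∀ k,
      unitaryGen Θ k * conjOp z y = conjOp z y * unitaryGen Θ k := by
    intro y hy k
    have h1 : unitaryGen Θ k = conjOp z (mFourier k (-z) • unitaryGen Θ k) := by
      rw [← conjOp_unitaryGen, conjOp_conjOp, add_neg_cancel, conjOp_zero]
    have h2 := ((StarSubalgebra.mem_centralizer_iff ℂ).1 hy _ ⟨k, rfl⟩).1
    rw [h1, ← conjOp_mul, ← conjOp_mul, smul_mul_assoc, mul_smul_comm, h2]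
  rw [StarSubalgebra.mem_centralizer_iff]
  rintro _ ⟨k, rfl⟩
  refine ⟨key y hy k, ?_⟩
  have := congrArg star (key (star y) (star_mem hy) k)
  rw [star_mul, star_mul, ← conjOp_star, star_star] at this
  exact this.symm

lemma conjOp_mem (Θ : Matrix (Fin n) (Fin n) ℝ) (z : UnitAddTorus (Fin n))
    {x : Hil n →L[ℂ] Hil n} (hx : x ∈ (quantumTorus Θ).toStarSubalgebra) :
    conjOp z x ∈ (quantumTorus Θ).toStarSubalgebra := by
  rw [mem_quantumTorus] at hx ⊢
  have key : ∀ y ∈ StarSubalgebra.centralizer ℂ (Set.range (unitaryGen Θ)),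
      y * conjOp z x = conjOp z x * y := by
    intro y hy
    have h1 : y = conjOp z (conjOp (-z) y) := by
      rw [conjOp_conjOp, add_neg_cancel, conjOp_zero]
    have h2 := (hx _ (conjOp_mem_commutant Θ (-z) hy)).1
    rw [h1, ← conjOp_mul, h2, conjOp_mul]
  exact fun y hy => ⟨key y hy, key _ (star_mem hy)⟩

/-- The translation action `σ_z` of `𝕋ⁿ` on `A_Θ` by (normal, as they are spatial)
`*`-homomorphisms; it is determined by `σ_z(u_k) = exp(2πi ⟨z, k⟩) u_k`. -/
def translation (Θ : Matrix (Fin n) (Fin n) ℝ) (z : UnitAddTorus (Fin n)) :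
    QT Θ →⋆ₐ[ℂ] QT Θ where
  toFun x := ⟨conjOp z x, conjOp_mem Θ z x.2⟩
  map_one' := by
    ext1
    change conjOp z 1 = 1
    simp [conjOp, diagUnitary_mul_neg]
  map_mul' x y := Subtype.ext (conjOp_mul z x y)
  map_zero' := by
    ext1
    change conjOp z 0 = 0
    simp [conjOp]
  map_add' x y := by
    ext1
    change conjOp z (x + y) = conjOp z x + conjOp z y
    simp [conjOp, mul_add, add_mul]
  commutes' a := by
    ext1
    change conjOp z (algebraMap ℂ _ a) = algebraMap ℂ _ a
    simp [conjOp, Algebra.algebraMap_eq_smul_one, diagUnitary_mul_neg]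
  map_star' x := Subtype.ext (conjOp_star z x)

lemma translation_gen (Θ : Matrix (Fin n) (Fin n) ℝ) (z : UnitAddTorus (Fin n))
    (k : Fin n → ℤ) : translation Θ z (gen Θ k) = mFourier k z • gen Θ k :=
  Subtype.ext (conjOp_unitaryGen Θ k z)

lemma translation_zero (Θ : Matrix (Fin n) (Fin n) ℝ) (f : QT Θ) : translation Θ 0 f = f :=
  Subtype.ext (conjOp_zero _)

lemma translation_add (Θ : Matrix (Fin n) (Fin n) ℝ) (z w : UnitAddTorus (Fin n)) (f : QT Θ) :
    translation Θ (z + w) f = translation Θ z (translation Θ w f) :=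
  Subtype.ext (conjOp_conjOp z w _).symm

end Action

section Transference

variable {n : ℕ}

open UnitAddTorus (mFourier)

/-- The normalized Haar measure `dz` of `𝕋ⁿ = (ℝ/ℤ)ⁿ`. -/
def torusMeasure (n : ℕ) : Measure (UnitAddTorus (Fin n)) :=
  Measure.pi fun _ => AddCircle.haarAddCircle

instance isProbabilityMeasure_torusMeasure (n : ℕ) : IsProbabilityMeasure (torusMeasure n) := by
  unfold torusMeasure
  infer_instance

lemma continuous_diagUnitary_apply (f : Hil n) :
    Continuous fun z : UnitAddTorus (Fin n) => diagUnitary z f := by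
  classical
  have hsum := lp.hasSum_single (p := 2) (by norm_num) f
  have hsingle : ∀ (k : Fin n → ℤ) (a : ℂ), Continuous fun z : UnitAddTorus (Fin n) =>
      diagUnitary z (lp.single 2 k a) := by
    intro k a
    have : (fun z : UnitAddTorus (Fin n) => diagUnitary z (lp.single 2 k a)) =
        fun z => mFourier k z • (lp.single 2 k a : Hil n) := by
      funext z
      ext l
      rw [diagUnitary_apply]
      change _ = mFourier k z * (lp.single 2 k a : Hil n) l
      by_cases h : l = k
      · rw [h]
      · rw [lp.single_apply_ne _ _ _ h, mul_zero, mul_zero]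
    rw [this]
    exact (mFourier k).continuous.smul continuous_const
  have hunif : TendstoUniformly
      (fun (s : Finset (Fin n → ℤ)) (z : UnitAddTorus (Fin n)) =>
        diagUnitary z (∑ k ∈ s, lp.single 2 k (f k)))
      (fun z => diagUnitary z f) Filter.atTop := by
    rw [Metric.tendstoUniformly_iff]
    intro ε hε
    filter_upwards [(Metric.tendsto_nhds.1 hsum) ε hε] with s hs z
    rw [dist_comm, dist_eq_norm, ← map_sub, norm_diagUnitary_apply, ← dist_eq_norm]
    exact hs
  refine hunif.continuous (Filter.Eventually.frequently (Filter.Eventually.of_forall fun s => ?_))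
  simp only [map_sum]
  exact continuous_finsetSum _ fun k _ => hsingle k _

lemma continuous_conjOp_apply (x : Hil n →L[ℂ] Hil n) (f : Hil n) :
    Continuous fun z : UnitAddTorus (Fin n) => conjOp z x f := by
  have h1 : Continuous fun p : Hil n × UnitAddTorus (Fin n) => diagUnitary p.2 p.1 := by
    refine continuous_prod_of_continuous_lipschitzWith _ 1 continuous_diagUnitary_apply ?_
    intro z
    refine LipschitzWith.of_dist_le_mul fun f g => ?_
    simp only [dist_eq_norm]
    rw [← map_sub, norm_diagUnitary_apply]
    simp
  have h2 : Continuous fun z : UnitAddTorus (Fin n) => x (diagUnitary (-z) f) :=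
    x.continuous.comp ((continuous_diagUnitary_apply f).comp continuous_neg)
  have h3 : Continuous fun z : UnitAddTorus (Fin n) => diagUnitary z (x (diagUnitary (-z) f)) :=
    Continuous.comp (g := fun p : Hil n × UnitAddTorus (Fin n) => diagUnitary p.2 p.1)
      (f := fun z => (x (diagUnitary (-z) f), z)) h1 (h2.prodMk continuous_id)
  refine h3.congr fun z => ?_
  simp only [conjOp, mul_apply_eq_comp]

lemma norm_conjOp_apply_le (z : UnitAddTorus (Fin n)) (x : Hil n →L[ℂ] Hil n) (f : Hil n) :
    ‖conjOp z x f‖ ≤ ‖x‖ * ‖f‖ := by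
  change ‖diagUnitary z (x (diagUnitary (-z) f))‖ ≤ _
  rw [norm_diagUnitary_apply]
  refine (x.le_opNorm _).trans ?_
  rw [norm_diagUnitary_apply]

lemma integrable_transfer (φ : C(UnitAddTorus (Fin n), ℂ)) (x : Hil n →L[ℂ] Hil n) (f : Hil n) :
    Integrable (fun z => φ z • conjOp z x f) (torusMeasure n) :=
  (φ.continuous.smul (continuous_conjOp_apply x f)).integrable_of_hasCompactSupport
    (HasCompactSupport.of_compactSpace _)

/-- The operator `f ↦ ∫ φ(z) V_z x V_z^* f dz`. -/
def averageOp (φ : C(UnitAddTorus (Fin n), ℂ)) (x : Hil n →L[ℂ] Hil n) : Hil n →L[ℂ] Hil n :=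
  LinearMap.mkContinuous
    { toFun := fun f => ∫ z, φ z • conjOp z x f ∂(torusMeasure n)
      map_add' := fun f g => by
        rw [← integral_add (integrable_transfer φ x f) (integrable_transfer φ x g)]
        simp only [map_add, smul_add]
      map_smul' := fun a f => by
        simp only [map_smul, RingHom.id_apply]
        rw [← integral_smul]
        simp only [smul_comm a] }
    (‖φ‖ * ‖x‖) (fun f => by
      refine (norm_integral_le_of_norm_le_const (C := ‖φ‖ * ‖x‖ * ‖f‖)
        (Filter.Eventually.of_forall fun z => ?_)).trans ?_
      · rw [norm_smul, mul_assoc]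
        exact mul_le_mul (φ.norm_coe_le_norm z) (norm_conjOp_apply_le z x f) (norm_nonneg _)
          (norm_nonneg _)
      · simp)

lemma averageOp_apply (φ : C(UnitAddTorus (Fin n), ℂ)) (x : Hil n →L[ℂ] Hil n) (f : Hil n) :
    averageOp φ x f = ∫ z, φ z • conjOp z x f ∂(torusMeasure n) := rfl

lemma norm_averageOp_le (φ : C(UnitAddTorus (Fin n), ℂ)) (x : Hil n →L[ℂ] Hil n) :
    ‖averageOp φ x‖ ≤ ‖φ‖ * ‖x‖ :=
  LinearMap.mkContinuous_norm_le _ (by positivity) _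

lemma averageOp_mem (Θ : Matrix (Fin n) (Fin n) ℝ) (φ : C(UnitAddTorus (Fin n), ℂ))
    {x : Hil n →L[ℂ] Hil n} (hx : x ∈ (quantumTorus Θ).toStarSubalgebra) :
    averageOp φ x ∈ (quantumTorus Θ).toStarSubalgebra := by
  have key : ∀ y ∈ StarSubalgebra.centralizer ℂ (Set.range (unitaryGen Θ)),
      y * averageOp φ x = averageOp φ x * y := by
    intro y hy
    ext1 f
    change y (averageOp φ x f) = averageOp φ x (y f)
    rw [averageOp_apply, averageOp_apply,
      ← ContinuousLinearMap.integral_comp_comm y (integrable_transfer φ x f)]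
    refine integral_congr_ae (Filter.Eventually.of_forall fun z => ?_)
    have := ((mem_quantumTorus Θ _).1 (conjOp_mem Θ z hx) y hy).1
    have := congrArg (fun T : Hil n →L[ℂ] Hil n => T f) this
    change y (conjOp z x f) = conjOp z x (y f) at this
    simp only [map_smul, this]
  rw [mem_quantumTorus]
  exact fun y hy => ⟨key y hy, key _ (star_mem hy)⟩

/-- The transferred convolution operator `f ↦ ∫ φ(z) σ_z(f) dz` on `A_Θ`, the integral being
taken in the strong operator topology; it is bilinear in `φ` and `f`. -/
def transfer (Θ : Matrix (Fin n) (Fin n) ℝ) :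
    C(UnitAddTorus (Fin n), ℂ) →L[ℂ] QT Θ →L[ℂ] QT Θ :=
  LinearMap.mkContinuous₂
    (LinearMap.mk₂ ℂ
      (fun (φ : C(UnitAddTorus (Fin n), ℂ)) (f : QT Θ) =>
        (⟨averageOp φ f, averageOp_mem Θ φ f.2⟩ : QT Θ))
      (fun φ ψ x => by
        ext1
        change averageOp (φ + ψ) x = averageOp φ x + averageOp ψ x
        ext1 f
        rw [add_apply]
        simp only [averageOp_apply]
        rw [← integral_add (integrable_transfer φ _ f) (integrable_transfer ψ _ f)]
        simp only [ContinuousMap.add_apply, add_smul])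
      (fun a φ x => by
        ext1
        change averageOp (a • φ) x = a • averageOp φ x
        ext1 f
        rw [smul_apply]
        simp only [averageOp_apply]
        rw [← integral_smul]
        simp only [ContinuousMap.smul_apply, smul_assoc])
      (fun φ x y => by
        ext1
        change averageOp φ (x + y) = averageOp φ x + averageOp φ y
        ext1 f
        rw [add_apply]
        simp only [averageOp_apply]
        rw [← integral_add (integrable_transfer φ _ f) (integrable_transfer φ _ f)]
        simp only [conjOp, mul_add, add_mul, add_apply, smul_add])
      (fun a φ x => by
        ext1
        change averageOp φ (a • x) = a • averageOp φ x
        ext1 f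
        rw [smul_apply]
        simp only [averageOp_apply]
        rw [← integral_smul]
        simp only [conjOp, mul_smul_comm, smul_mul_assoc, smul_apply,
          smul_comm a]))
    1 (fun φ x => by
      rw [one_mul]
      exact norm_averageOp_le φ x)

lemma transfer_apply (Θ : Matrix (Fin n) (Fin n) ℝ) (φ : C(UnitAddTorus (Fin n), ℂ)) (f : QT Θ)
    (ξ : Hil n) : (transfer Θ φ f : Hil n →L[ℂ] Hil n) ξ =
      ∫ z, φ z • (translation Θ z f : Hil n →L[ℂ] Hil n) ξ ∂(torusMeasure n) := rfl

end Transference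
section Semigroups

variable {n : ℕ}

open UnitAddTorus (mFourier)

/-- The eigenvalue `4π²|k|²` of the Laplacian of `𝕋ⁿ` at the frequency `k ∈ ℤⁿ`. -/
def laplaceEig (k : Fin n → ℤ) : ℝ := 4 * Real.pi ^ 2 * ∑ i, (k i : ℝ) ^ 2

/-- The continuous function `∑ₖ m(k) exp(2πi ⟨k, z⟩)` on `𝕋ⁿ`, for summable `m`. -/
def kernel (m : (Fin n → ℤ) → ℝ) : C(UnitAddTorus (Fin n), ℂ) := ∑' k, (m k : ℂ) • mFourier k

/-- The heat kernel `h_t(z)` of `𝕋ⁿ`, for `t > 0`. -/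
def heatKernel (n : ℕ) (t : ℝ) : C(UnitAddTorus (Fin n), ℂ) :=
  kernel fun k => Real.exp (-t * laplaceEig k)

/-- The Poisson kernel `p_s(z)` of `𝕋ⁿ`, for `s > 0`. -/
def poissonKernel (n : ℕ) (s : ℝ) : C(UnitAddTorus (Fin n), ℂ) :=
  kernel fun k => Real.exp (-s * √(laplaceEig k))

/-- The heat semigroup `T_t f = ∫ h_t(z) σ_z(f) dz` on `A_Θ`, for `t > 0`. -/
def heat (Θ : Matrix (Fin n) (Fin n) ℝ) (t : ℝ) : QT Θ →L[ℂ] QT Θ :=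
  transfer Θ (heatKernel n t)

/-- The Poisson semigroup `P_s f = ∫ p_s(z) σ_z(f) dz` on `A_Θ` associated with the heat
semigroup, for `s > 0`. -/
def poisson (Θ : Matrix (Fin n) (Fin n) ℝ) (s : ℝ) : QT Θ →L[ℂ] QT Θ :=
  transfer Θ (poissonKernel n s)

lemma summable_exp_abs {c : ℝ} (hc : 0 < c) :
    Summable fun k : ℤ => Real.exp (-c * |(k : ℝ)|) := by
  have h : Summable fun m : ℕ => Real.exp (-c * (m : ℝ)) := by
    have := Real.summable_exp_nat_mul_iff.mpr (neg_lt_zero.mpr hc)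
    exact this.congr fun m => by rw [mul_comm]
  refine Summable.of_nat_of_neg ?_ ?_
  · exact h.congr fun m => by simp
  · exact h.congr fun m => by simp

lemma summable_exp_sum_abs {c : ℝ} (hc : 0 < c) :
    Summable fun k : Fin n → ℤ => Real.exp (-c * ∑ i, |(k i : ℝ)|) := by
  classical
  have h1 := summable_exp_abs hc
  refine summable_of_sum_le (c := (∑' k : ℤ, Real.exp (-c * |(k : ℝ)|)) ^ n)
    (fun k => (Real.exp_pos _).le) fun S => ?_
  let B : Finset ℤ := S.biUnion fun k => Finset.univ.image k
  have hsub : S ⊆ Fintype.piFinset fun _ : Fin n => B := by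
    intro k hk
    rw [Fintype.mem_piFinset]
    exact fun i => Finset.mem_biUnion.2 ⟨k, hk, Finset.mem_image_of_mem _ (Finset.mem_univ i)⟩
  calc ∑ k ∈ S, Real.exp (-c * ∑ i, |(k i : ℝ)|)
      ≤ ∑ k ∈ Fintype.piFinset fun _ : Fin n => B, Real.exp (-c * ∑ i, |(k i : ℝ)|) :=
        Finset.sum_le_sum_of_subset_of_nonneg hsub fun _ _ _ => (Real.exp_pos _).le
    _ = ∏ _i : Fin n, ∑ m ∈ B, Real.exp (-c * |(m : ℝ)|) := by
        rw [Finset.prod_univ_sum]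
        refine Finset.sum_congr rfl fun k _ => ?_
        rw [Finset.mul_sum, Real.exp_sum]
    _ = (∑ m ∈ B, Real.exp (-c * |(m : ℝ)|)) ^ n := by simp
    _ ≤ _ := pow_le_pow_left₀ (Finset.sum_nonneg fun _ _ => (Real.exp_pos _).le)
        (h1.sum_le_tsum B fun _ _ => (Real.exp_pos _).le) n

lemma sum_abs_le_sqrt (k : Fin n → ℤ) :
    ∑ i, |(k i : ℝ)| ≤ (n + 1) * √(laplaceEig k) := by
  have h1 : ∀ i, |(k i : ℝ)| ≤ √(laplaceEig k) := by
    intro i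
    refine Real.abs_le_sqrt ?_
    have h2 : (k i : ℝ) ^ 2 ≤ ∑ i, (k i : ℝ) ^ 2 :=
      Finset.single_le_sum (f := fun i => (k i : ℝ) ^ 2) (fun i _ => sq_nonneg _)
        (Finset.mem_univ i)
    have h3 : (1 : ℝ) ≤ 4 * Real.pi ^ 2 := by nlinarith [Real.pi_gt_three]
    unfold laplaceEig
    nlinarith [sq_nonneg (k i : ℝ)]
  calc ∑ i, |(k i : ℝ)| ≤ ∑ _i : Fin n, √(laplaceEig k) := Finset.sum_le_sum fun i _ => h1 i
    _ = n * √(laplaceEig k) := by simp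
    _ ≤ _ := by nlinarith [Real.sqrt_nonneg (laplaceEig k)]

lemma summable_exp_poisson {c : ℝ} (hc : 0 < c) :
    Summable fun k : Fin n → ℤ => Real.exp (-c * √(laplaceEig k)) := by
  have hc' : 0 < c / (n + 1) := by positivity
  refine (summable_exp_sum_abs hc').of_nonneg_of_le (fun _ => (Real.exp_pos _).le) fun k => ?_
  refine Real.exp_le_exp.2 ?_
  have h := sum_abs_le_sqrt k
  have h2 : c / (n + 1) * ∑ i, |(k i : ℝ)| ≤ c / (n + 1) * ((n + 1) * √(laplaceEig k)) :=
    mul_le_mul_of_nonneg_left h hc'.le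
  have h3 : c / (n + 1) * ((n + 1) * √(laplaceEig k)) = c * √(laplaceEig k) := by
    field_simp
  linarith

lemma summable_exp_heat {t : ℝ} (ht : 0 < t) :
    Summable fun k : Fin n → ℤ => Real.exp (-t * laplaceEig k) := by
  refine ((summable_exp_poisson ht).mul_left (Real.exp t)).of_nonneg_of_le
    (fun _ => (Real.exp_pos _).le) fun k => ?_
  rw [← Real.exp_add]
  refine Real.exp_le_exp.2 ?_
  have h0 : 0 ≤ laplaceEig k := by unfold laplaceEig; positivity
  nlinarith [sq_nonneg (√(laplaceEig k) - 1), Real.sq_sqrt h0, Real.sqrt_nonneg (laplaceEig k)]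

lemma norm_smul_mFourier (a : ℝ) (k : Fin n → ℤ) : ‖(a : ℂ) • mFourier k‖ = |a| := by
  rw [norm_smul, UnitAddTorus.mFourier_norm, mul_one, Complex.norm_real, Real.norm_eq_abs]

lemma hasSum_kernel {m : (Fin n → ℤ) → ℝ} (hm : Summable m) :
    HasSum (fun k => (m k : ℂ) • mFourier k) (kernel m) := by
  refine (Summable.of_norm ?_).hasSum
  simpa only [norm_smul_mFourier] using hm.abs

lemma integral_mFourier (k : Fin n → ℤ) :
    ∫ z, mFourier k z ∂(torusMeasure n) = if k = 0 then 1 else 0 := by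
  have h := MeasureTheory.integral_fintype_prod_eq_prod (𝕜 := ℂ)
    (μ := fun _ : Fin n => (AddCircle.haarAddCircle : Measure UnitAddCircle))
    (fun (i : Fin n) (x : UnitAddCircle) => fourier (k i) x)
  have h0 : ∀ j : ℤ, ∫ x : UnitAddCircle, fourier j x ∂AddCircle.haarAddCircle =
      if j = 0 then 1 else 0 := by
    intro j
    split_ifs with hj
    · subst hj; simp
    · have h1 := (orthonormal_iff_ite.mp (orthonormal_fourier (T := 1))) 0 j
      rw [if_neg (Ne.symm hj), ContinuousMap.inner_toLp] at h1
      simpa using h1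
  change ∫ z, (∏ i, fourier (k i) (z i)) ∂(torusMeasure n) = _
  rw [torusMeasure, h]
  simp only [h0]
  split_ifs with hk
  · subst hk; simp
  · obtain ⟨i, hi⟩ := Function.ne_iff.mp hk
    exact Finset.prod_eq_zero (Finset.mem_univ i) (if_neg hi)

lemma transfer_mFourier_gen (Θ : Matrix (Fin n) (Fin n) ℝ) (j k : Fin n → ℤ) :
    transfer Θ (mFourier j) (gen Θ k) = (if j + k = 0 then (1 : ℂ) else 0) • gen Θ k := by
  ext1
  change averageOp (mFourier j) (unitaryGen Θ k) = (if j + k = 0 then (1 : ℂ) else 0) •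
    unitaryGen Θ k
  ext1 ξ
  rw [averageOp_apply, smul_apply, ← integral_mFourier, ← integral_smul_const]
  refine integral_congr_ae (Filter.Eventually.of_forall fun z => ?_)
  simp only [conjOp_unitaryGen, smul_apply, smul_smul, UnitAddTorus.mFourier_add]

lemma transfer_kernel_gen (Θ : Matrix (Fin n) (Fin n) ℝ) {m : (Fin n → ℤ) → ℝ}
    (hm : Summable m) (k : Fin n → ℤ) :
    transfer Θ (kernel m) (gen Θ k) = (m (-k) : ℂ) • gen Θ k := by
  have h1 := ((transfer Θ).flip (gen Θ k)).hasSum (hasSum_kernel hm)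
  refine h1.unique ?_
  have h2 := hasSum_ite_eq (-k) ((m (-k) : ℂ) • gen Θ k)
  refine h2.congr_fun fun j => ?_
  simp only [ContinuousLinearMap.flip_apply, map_smul, transfer_mFourier_gen,
    add_eq_zero_iff_eq_neg]
  split_ifs with h
  · subst h; simp
  · simp

lemma laplaceEig_neg (k : Fin n → ℤ) : laplaceEig (-k) = laplaceEig k := by
  simp [laplaceEig]

/-- `T_t(u_k) = exp(-4π²|k|²t) u_k`. -/
lemma heat_gen (Θ : Matrix (Fin n) (Fin n) ℝ) {t : ℝ} (ht : 0 < t) (k : Fin n → ℤ) :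
    heat Θ t (gen Θ k) = (Real.exp (-t * laplaceEig k) : ℂ) • gen Θ k := by
  rw [heat, heatKernel, transfer_kernel_gen Θ (summable_exp_heat ht), laplaceEig_neg]

/-- `P_s(u_k) = exp(-2π|k|s) u_k`. -/
lemma poisson_gen (Θ : Matrix (Fin n) (Fin n) ℝ) {s : ℝ} (hs : 0 < s) (k : Fin n → ℤ) :
    poisson Θ s (gen Θ k) = (Real.exp (-s * √(laplaceEig k)) : ℂ) • gen Θ k := by
  rw [poisson, poissonKernel, transfer_kernel_gen Θ (summable_exp_poisson hs), laplaceEig_neg]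

lemma differentiableAt_poissonKernel {s : ℝ} (hs : 0 < s) :
    DifferentiableAt ℝ (poissonKernel n) s := by
  have hu : Summable fun k : Fin n → ℤ => (4 / s) * Real.exp (-(s / 4) * √(laplaceEig k)) :=
    (summable_exp_poisson (by positivity)).mul_left _
  have hmem : s ∈ Set.Ioi (s / 2) := by
    rw [Set.mem_Ioi]; linarith
  have h := hasDerivAt_tsum_of_isPreconnected (𝕜 := ℝ) (F := C(UnitAddTorus (Fin n), ℂ))
    (g := fun k r => (Real.exp (-r * √(laplaceEig k)) : ℂ) • mFourier k)
    (g' := fun k r => ((-√(laplaceEig k) * Real.exp (-r * √(laplaceEig k)) : ℝ) : ℂ) • mFourier k)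
    (y₀ := s) (y := s) hu isOpen_Ioi isPreconnected_Ioi ?_ ?_ hmem ?_ hmem
  · exact h.differentiableAt
  · intro k r _
    have h1 : HasDerivAt (fun r : ℝ => Real.exp (-r * √(laplaceEig k)))
        (-√(laplaceEig k) * Real.exp (-r * √(laplaceEig k))) r := by
      have := ((hasDerivAt_id r).neg.mul_const (√(laplaceEig k))).exp
      refine this.congr_deriv ?_
      simp [mul_comm]
    exact HasDerivAt.smul_const (𝕜' := ℂ) h1.ofReal_comp (mFourier k)
  · intro k r hr
    rw [norm_smul_mFourier, abs_mul, abs_neg, abs_of_nonneg (Real.sqrt_nonneg _),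
      abs_of_pos (Real.exp_pos _)]
    set q := √(laplaceEig k)
    have hq : 0 ≤ q := Real.sqrt_nonneg _
    have hr' : s / 2 < r := hr
    have h1 : q ≤ (4 / s) * Real.exp (s / 4 * q) := by
      have := Real.add_one_le_exp (s / 4 * q)
      calc q = (4 / s) * (s / 4 * q) := by field_simp
        _ ≤ _ := mul_le_mul_of_nonneg_left (by linarith) (by positivity)
    calc q * Real.exp (-r * q) ≤ (4 / s) * Real.exp (s / 4 * q) * Real.exp (-(s / 2) * q) := by
          refine mul_le_mul h1 (Real.exp_le_exp.2 (by nlinarith)) (Real.exp_pos _).le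
            (by positivity)
      _ = _ := by
          rw [mul_assoc, ← Real.exp_add]
          congr 2
          ring
  · exact (hasSum_kernel (summable_exp_poisson hs)).summable

/-- For `f ∈ A_Θ` the map `s ↦ P_s f` is norm-differentiable on `(0, ∞)`. -/
lemma differentiableAt_poisson (Θ : Matrix (Fin n) (Fin n) ℝ) (f : QT Θ) {s : ℝ} (hs : 0 < s) :
    DifferentiableAt ℝ (fun r => poisson Θ r f) s :=
  (((transfer Θ).flip f).restrictScalars ℝ).differentiableAt.comp s
    (differentiableAt_poissonKernel hs)

end Semigroups

section Hoelder

variable {n : ℕ}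

/-- The semigroup Hölder norm
`‖f‖_{Λ_α} = max {‖f‖, sup_{s > 0} ‖s^{1-α} (d/ds) P_s f‖}`, with values in `[0, ∞]`. -/
def semigroupNorm (Θ : Matrix (Fin n) (Fin n) ℝ) (α : ℝ) (f : QT Θ) : ℝ≥0∞ :=
  max ‖f‖ₑ (⨆ s : ℝ, ⨆ _ : 0 < s, ‖s ^ (1 - α) • deriv (fun r => poisson Θ r f) s‖ₑ)

/-- The Euclidean distance `|z|` of `z ∈ 𝕋ⁿ = ℝⁿ/ℤⁿ` to `0`; here `‖z i‖` is the distance of a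
representative of `z i` to the nearest integer. -/
def torusAbs (z : UnitAddTorus (Fin n)) : ℝ := √(∑ i, ‖z i‖ ^ 2)

/-- Weaver's Hölder norm
`‖f‖_α = max {‖f‖, sup_{z ≠ 0} ‖σ_z(f) - f‖ / |z|^α}`, with values in `[0, ∞]`. -/
def weaverNorm (Θ : Matrix (Fin n) (Fin n) ℝ) (α : ℝ) (f : QT Θ) : ℝ≥0∞ :=
  max ‖f‖ₑ (⨆ z : UnitAddTorus (Fin n), ⨆ _ : z ≠ 0,
    ‖translation Θ z f - f‖ₑ / ENNReal.ofReal (torusAbs z ^ α))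

lemma semigroupNorm_add_le (Θ : Matrix (Fin n) (Fin n) ℝ) (α : ℝ) (f g : QT Θ) :
    semigroupNorm Θ α (f + g) ≤ semigroupNorm Θ α f + semigroupNorm Θ α g := by
  refine max_le ((enorm_add_le _ _).trans (add_le_add (le_max_left _ _) (le_max_left _ _))) ?_
  refine iSup₂_le fun s hs => ?_
  have h : deriv (fun r => poisson Θ r (f + g)) s =
      deriv (fun r => poisson Θ r f) s + deriv (fun r => poisson Θ r g) s := by
    simp only [map_add]
    exact deriv_fun_add (differentiableAt_poisson Θ f hs) (differentiableAt_poisson Θ g hs)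
  rw [h, smul_add]
  refine (enorm_add_le _ _).trans (add_le_add ?_ ?_)
  · exact le_max_of_le_right
      (le_iSup₂ (f := fun s (_ : 0 < s) => ‖s ^ (1 - α) • deriv (fun r => poisson Θ r f) s‖ₑ) s hs)
  · exact le_max_of_le_right
      (le_iSup₂ (f := fun s (_ : 0 < s) => ‖s ^ (1 - α) • deriv (fun r => poisson Θ r g) s‖ₑ) s hs)

lemma semigroupNorm_smul_le (Θ : Matrix (Fin n) (Fin n) ℝ) (α : ℝ) (a : ℂ) (f : QT Θ) :
    semigroupNorm Θ α (a • f) ≤ ‖a‖ₑ * semigroupNorm Θ α f := by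
  refine max_le ?_ (iSup₂_le fun s hs => ?_)
  · rw [enorm_smul]
    exact mul_le_mul_right (le_max_left _ _) _
  · have h : deriv (fun r => poisson Θ r (a • f)) s = a • deriv (fun r => poisson Θ r f) s := by
      simp only [map_smul]
      exact deriv_fun_const_smul a (differentiableAt_poisson Θ f hs)
    rw [h, smul_comm, enorm_smul]
    exact mul_le_mul_right (le_max_of_le_right
      (le_iSup₂ (f := fun s (_ : 0 < s) => ‖s ^ (1 - α) • deriv (fun r => poisson Θ r f) s‖ₑ)
        s hs)) _

lemma weaverNorm_add_le (Θ : Matrix (Fin n) (Fin n) ℝ) (α : ℝ) (f g : QT Θ) :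
    weaverNorm Θ α (f + g) ≤ weaverNorm Θ α f + weaverNorm Θ α g := by
  refine max_le ((enorm_add_le _ _).trans (add_le_add (le_max_left _ _) (le_max_left _ _))) ?_
  refine iSup₂_le fun z hz => ?_
  have h : translation Θ z (f + g) - (f + g) =
      (translation Θ z f - f) + (translation Θ z g - g) := by
    rw [map_add]; abel
  rw [h]
  refine (ENNReal.div_le_div_right (enorm_add_le _ _) _).trans ?_
  rw [ENNReal.add_div]
  refine add_le_add ?_ ?_
  · exact le_max_of_le_right (le_iSup₂ (f := fun z (_ : z ≠ 0) =>
      ‖translation Θ z f - f‖ₑ / ENNReal.ofReal (torusAbs z ^ α)) z hz)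
  · exact le_max_of_le_right (le_iSup₂ (f := fun z (_ : z ≠ 0) =>
      ‖translation Θ z g - g‖ₑ / ENNReal.ofReal (torusAbs z ^ α)) z hz)

lemma weaverNorm_smul_le (Θ : Matrix (Fin n) (Fin n) ℝ) (α : ℝ) (a : ℂ) (f : QT Θ) :
    weaverNorm Θ α (a • f) ≤ ‖a‖ₑ * weaverNorm Θ α f := by
  refine max_le ?_ (iSup₂_le fun z hz => ?_)
  · rw [enorm_smul]
    exact mul_le_mul_right (le_max_left _ _) _
  · rw [map_smul, ← smul_sub, enorm_smul, mul_div_assoc]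
    exact mul_le_mul_right (le_max_of_le_right (le_iSup₂ (f := fun z (_ : z ≠ 0) =>
      ‖translation Θ z f - f‖ₑ / ENNReal.ofReal (torusAbs z ^ α)) z hz)) _

/-- The semigroup Hölder space `Λ_α(T) = {f ∈ A_Θ : ‖f‖_{Λ_α} < ∞}`. -/
def SemigroupHoelder (Θ : Matrix (Fin n) (Fin n) ℝ) (α : ℝ) : Submodule ℂ (QT Θ) where
  carrier := {f | semigroupNorm Θ α f < ∞}
  add_mem' := fun {f g} hf hg =>
    (semigroupNorm_add_le Θ α f g).trans_lt (ENNReal.add_lt_top.2 ⟨hf, hg⟩)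
  zero_mem' := by simp [semigroupNorm]
  smul_mem' a f hf :=
    (semigroupNorm_smul_le Θ α a f).trans_lt (ENNReal.mul_lt_top enorm_lt_top hf)

/-- Weaver's Hölder space `Lip_α(A_Θ) = {f ∈ A_Θ : ‖f‖_α < ∞}`. -/
def WeaverHoelder (Θ : Matrix (Fin n) (Fin n) ℝ) (α : ℝ) : Submodule ℂ (QT Θ) where
  carrier := {f | weaverNorm Θ α f < ∞}
  add_mem' := fun {f g} hf hg =>
    (weaverNorm_add_le Θ α f g).trans_lt (ENNReal.add_lt_top.2 ⟨hf, hg⟩)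
  zero_mem' := by simp [weaverNorm]
  smul_mem' a f hf :=
    (weaverNorm_smul_le Θ α a f).trans_lt (ENNReal.mul_lt_top enorm_lt_top hf)

end Hoelder

end QTorus

end

/-! The operators in play are all Fourier multipliers: in the basis of `ℓ²(ℤⁿ)`, the matrix
coefficient of `f` at `(l, k)` is multiplied by the character of frequency `l - k` under
translation, by `exp (-t L)` under the heat semigroup and by `exp (-s √L)` under the Poisson
semigroup, with `L = laplaceEig (l - k)`. Hence an integral formula between these operators amounts
to a scalar identity, and `norm_le_integral_of_coef_eq` turns such a formula into a norm estimate.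
It serves as a weak Minkowski inequality and does not need norm measurability of the integrand,
which matters because `z ↦ σ_z f` need not be norm continuous. The dependence on `Θ` disappears,
since the constants come from scalar integrals only.

Two representations supply the formulas. The heat operator is a Gaussian average of translations,
`T_t f = 𝔼 σ_{√t Y} f`, where `Y` has independent centred coordinates of variance 2; Gaussian
integration by parts gives the gradient bound `‖σ_z T_t g - T_t g‖ ≤ C |z| t^{-1/2} ‖g‖`. The
Poisson semigroup is subordinate to it, `P_s = (2/√π) ∫₀^∞ e^{-u²} T_{(s/2u)²} du`.

From translations to the semigroup: Hölder continuity gives `‖T_t f - f‖ ≤ C M t^{α/2}`. The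
`s`-derivative of the subordination formula has the weight `(1 - 2u²) e^{-u²}`, whose integral
vanishes, so `T f` may be replaced by `T f - f`; the result is of size `s^{α-1}`
(`norm_deriv_poisson_le`).

From the semigroup to translations: split `f = (f - P_s f) + P_s f`. Integrating `∂_r P_r f` over
`(0, s)` controls the first term by `s^α` (`norm_sub_poisson_le`). For the second, `∂_r P_r f =
P_{r/2} (∂P f)(r/2)` and the gradient bound give an integrand of size `|z| r^{α-2}` over `(s, ∞)`,
hence `|z| s^{α-1}` (`norm_translation_poisson_sub_le_of_deriv`). The choice `s = |z|` balances the
two. -/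

namespace QTorus

/-! ### Matrix coefficients and the weak Minkowski inequality -/

section Coefficients

variable {n : ℕ}

open UnitAddTorus (mFourier)

/-- The matrix coefficient `f ↦ (f e_k)(l)` on `A_Θ`. -/
noncomputable def coef (Θ : Matrix (Fin n) (Fin n) ℝ) (l k : Fin n → ℤ) : QT Θ →L[ℂ] ℂ :=
  (lp.evalCLM ℂ (fun _ : Fin n → ℤ => ℂ) 2 l).comp
    ((ContinuousLinearMap.apply ℂ (Hil n) (lp.single 2 k (1 : ℂ))).comp
      (quantumTorus Θ).toStarSubalgebra.toSubalgebra.toSubmodule.subtypeL)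

lemma coef_apply (Θ : Matrix (Fin n) (Fin n) ℝ) (l k : Fin n → ℤ) (f : QT Θ) :
    coef Θ l k f = (f : Hil n →L[ℂ] Hil n) (lp.single 2 k (1 : ℂ)) l := rfl

lemma norm_coef_le (Θ : Matrix (Fin n) (Fin n) ℝ) (l k : Fin n → ℤ) (f : QT Θ) :
    ‖coef Θ l k f‖ ≤ ‖f‖ := by
  rw [coef_apply]
  refine (lp.norm_apply_le_norm (by norm_num) _ l).trans ?_
  refine ((f : Hil n →L[ℂ] Hil n).le_opNorm _).trans ?_
  rw [lp.norm_single (by norm_num), norm_one, mul_one]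
  rfl

lemma diagUnitary_single (z : UnitAddTorus (Fin n)) (k : Fin n → ℤ) :
    diagUnitary z (lp.single 2 k (1 : ℂ)) = mFourier k z • (lp.single 2 k (1 : ℂ) : Hil n) := by
  ext l
  rw [diagUnitary_apply]
  change _ = mFourier k z * (lp.single 2 k (1 : ℂ) : Hil n) l
  by_cases h : l = k
  · rw [h]
  · rw [lp.single_apply_ne _ _ _ h, mul_zero, mul_zero]

/-- Basis vectors are eigenvectors of the diagonal unitaries, so conjugation contributes the
character of `l` from the left and the conjugate character of `k` from the right. -/
lemma coef_translation (Θ : Matrix (Fin n) (Fin n) ℝ) (l k : Fin n → ℤ)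
    (z : UnitAddTorus (Fin n)) (f : QT Θ) :
    coef Θ l k (translation Θ z f) = mFourier (l - k) z * coef Θ l k f := by
  rw [coef_apply, coef_apply]
  change diagUnitary z ((f : Hil n →L[ℂ] Hil n) (diagUnitary (-z) (lp.single 2 k 1))) l = _
  rw [diagUnitary_single, map_smul, diagUnitary_apply, sub_eq_add_neg,
    UnitAddTorus.mFourier_add, UnitAddTorus.mFourier_neg, mFourier_apply_neg, mul_assoc]
  rfl

lemma coef_transfer_mFourier (Θ : Matrix (Fin n) (Fin n) ℝ) (l k j : Fin n → ℤ) (f : QT Θ) :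
    coef Θ l k (transfer Θ (mFourier j) f) =
      (if j + (l - k) = 0 then (1 : ℂ) else 0) * coef Θ l k f := by
  have h : coef Θ l k (transfer Θ (mFourier j) f) =
      lp.evalCLM ℂ (fun _ : Fin n → ℤ => ℂ) 2 l
        (∫ z, mFourier j z • conjOp z f (lp.single 2 k 1) ∂(torusMeasure n)) := rfl
  rw [h, ← ContinuousLinearMap.integral_comp_comm _ (integrable_transfer _ _ _),
    ← integral_mFourier, ← integral_mul_const]
  refine integral_congr_ae (Filter.Eventually.of_forall fun z => ?_)
  have h2 := coef_translation Θ l k z f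
  simp only [map_smul, UnitAddTorus.mFourier_add, smul_eq_mul, mul_assoc]
  rw [← h2]
  rfl

/-- Orthogonality of characters leaves only the term of frequency `-(l - k)` in the Fourier series
of the kernel. Unlike the formula on generators, this applies to every `f`, with no density
argument. -/
lemma coef_transfer_kernel (Θ : Matrix (Fin n) (Fin n) ℝ) {m : (Fin n → ℤ) → ℝ}
    (hm : Summable m) (l k : Fin n → ℤ) (f : QT Θ) :
    coef Θ l k (transfer Θ (kernel m) f) = m (-(l - k)) * coef Θ l k f := by
  have h1 := ((coef Θ l k).comp ((transfer Θ).flip f)).hasSum (hasSum_kernel hm)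
  refine h1.unique ?_
  have h2 := hasSum_ite_eq (-(l - k)) ((m (-(l - k)) : ℂ) * coef Θ l k f)
  refine h2.congr_fun fun j => ?_
  simp only [ContinuousLinearMap.comp_apply, ContinuousLinearMap.flip_apply, map_smul,
    coef_transfer_mFourier, add_eq_zero_iff_eq_neg]
  split_ifs with h
  · subst h; simp
  · simp

lemma coef_heat (Θ : Matrix (Fin n) (Fin n) ℝ) {t : ℝ} (ht : 0 < t) (l k : Fin n → ℤ)
    (f : QT Θ) :
    coef Θ l k (heat Θ t f) = Real.exp (-t * laplaceEig (l - k)) * coef Θ l k f := by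
  rw [heat, heatKernel, coef_transfer_kernel Θ (summable_exp_heat ht), laplaceEig_neg]

lemma coef_poisson (Θ : Matrix (Fin n) (Fin n) ℝ) {s : ℝ} (hs : 0 < s) (l k : Fin n → ℤ)
    (f : QT Θ) :
    coef Θ l k (poisson Θ s f) = Real.exp (-s * √(laplaceEig (l - k))) * coef Θ l k f := by
  rw [poisson, poissonKernel, coef_transfer_kernel Θ (summable_exp_poisson hs), laplaceEig_neg]

lemma hasDerivAt_exp_neg_mul (c s : ℝ) :
    HasDerivAt (fun r : ℝ => Real.exp (-r * c)) (-c * Real.exp (-s * c)) s := by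
  refine ((hasDerivAt_id s).neg.mul_const c).exp.congr_deriv ?_
  simp [mul_comm]

lemma coef_deriv_poisson (Θ : Matrix (Fin n) (Fin n) ℝ) {s : ℝ} (hs : 0 < s)
    (l k : Fin n → ℤ) (f : QT Θ) :
    coef Θ l k (deriv (fun r => poisson Θ r f) s) =
      ((-√(laplaceEig (l - k)) * Real.exp (-s * √(laplaceEig (l - k))) : ℝ) : ℂ) *
        coef Θ l k f := by
  have h1 := (((coef Θ l k).restrictScalars ℝ).hasFDerivAt).comp_hasDerivAt s
    (differentiableAt_poisson Θ f hs).hasDerivAt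
  have h2 := ((hasDerivAt_exp_neg_mul (√(laplaceEig (l - k))) s).ofReal_comp).mul_const
    (coef Θ l k f)
  refine h1.unique (h2.congr_of_eventuallyEq ?_)
  filter_upwards [lt_mem_nhds hs] with r hr
  exact coef_poisson Θ hr l k f

lemma norm_translation_le (Θ : Matrix (Fin n) (Fin n) ℝ) (z : UnitAddTorus (Fin n))
    (f : QT Θ) : ‖translation Θ z f‖ ≤ ‖f‖ :=
  ContinuousLinearMap.opNorm_le_bound _ (norm_nonneg _) (norm_conjOp_apply_le z f)

open Filter Topology in
/-- An element of `A_Θ` whose matrix coefficients are the integrals of those of a family `F` has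
norm at most the integral of a majorant of `‖F‖`. -/
theorem norm_le_integral_of_coef_eq (Θ : Matrix (Fin n) (Fin n) ℝ) {X : Type*}
    [MeasurableSpace X] {μ : Measure X} {g : QT Θ} {F : X → QT Θ} {B : X → ℝ}
    (hB : Integrable B μ) (hFB : ∀ᵐ x ∂μ, ‖F x‖ ≤ B x)
    (hF : ∀ l k, AEStronglyMeasurable (fun x => coef Θ l k (F x)) μ)
    (hg : ∀ l k, coef Θ l k g = ∫ x, coef Θ l k (F x) ∂μ) : ‖g‖ ≤ ∫ x, B x ∂μ := by
  classical
  have hB0 : 0 ≤ ∫ x, B x ∂μ :=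
    integral_nonneg_of_ae (hFB.mono fun x hx => (norm_nonneg _).trans hx)
  have hint : ∀ l k, Integrable (fun x => coef Θ l k (F x)) μ := fun l k =>
    hB.mono' (hF l k) (hFB.mono fun x hx => (norm_coef_le Θ l k _).trans hx)
  -- Truncation to finitely many coordinates: the pairings then involve finitely many coefficients,
  -- so the integral passes through them. The bound survives the limit because `g` is bounded.
  let tr : Finset (Fin n → ℤ) → Hil n → Hil n := fun S ξ => ∑ k ∈ S, lp.single 2 k (ξ k)
  have htr : ∀ ξ, Tendsto (fun S => tr S ξ) atTop (𝓝 ξ) := fun ξ =>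
    lp.hasSum_single (p := 2) (by norm_num) ξ
  have hsingle : ∀ (k : Fin n → ℤ) (a : ℂ),
      (lp.single 2 k a : Hil n) = a • (lp.single 2 k (1 : ℂ) : Hil n) := by
    intro k a
    rw [← lp.single_smul, smul_eq_mul, mul_one]
  have hexp : ∀ S (ξ η : Hil n) (x : QT Θ), inner ℂ (tr S η) ((x : Hil n →L[ℂ] Hil n) (tr S ξ)) =
      ∑ l ∈ S, ∑ k ∈ S, (starRingEnd ℂ (η l) * ξ k) * coef Θ l k x := by
    intro S ξ η x
    simp only [tr, map_sum, sum_inner, inner_sum]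
    rw [Finset.sum_comm]
    refine Finset.sum_congr rfl fun l _ => Finset.sum_congr rfl fun k _ => ?_
    rw [lp.inner_single_left, hsingle k, map_smul, coef_apply, RCLike.inner_apply]
    change (ξ _ * _) * _ = _
    ring
  have hfin : ∀ S (ξ η : Hil n), ‖inner ℂ (tr S η) ((g : Hil n →L[ℂ] Hil n) (tr S ξ))‖ ≤
      (∫ x, B x ∂μ) * (‖tr S η‖ * ‖tr S ξ‖) := by
    intro S ξ η
    have h1 : inner ℂ (tr S η) ((g : Hil n →L[ℂ] Hil n) (tr S ξ)) =
        ∫ x, inner ℂ (tr S η) ((F x : Hil n →L[ℂ] Hil n) (tr S ξ)) ∂μ := by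
      simp only [hexp]
      rw [integral_finsetSum _ fun l _ => integrable_finsetSum _ fun k _ =>
        (hint l k).const_mul _]
      refine Finset.sum_congr rfl fun l _ => ?_
      rw [integral_finsetSum _ fun k _ => (hint l k).const_mul _]
      refine Finset.sum_congr rfl fun k _ => ?_
      rw [integral_const_mul, hg]
    rw [h1, ← integral_mul_const]
    refine norm_integral_le_of_norm_le (hB.mul_const _) (hFB.mono fun x hx => ?_)
    refine (norm_inner_le_norm _ _).trans ?_
    calc ‖tr S η‖ * ‖(F x : Hil n →L[ℂ] Hil n) (tr S ξ)‖
        ≤ ‖tr S η‖ * (B x * ‖tr S ξ‖) := by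
          gcongr
          exact ((F x : Hil n →L[ℂ] Hil n).le_opNorm _).trans
            (mul_le_mul_of_nonneg_right hx (norm_nonneg _))
      _ = _ := by ring
  have hall : ∀ ξ η : Hil n, ‖inner ℂ η ((g : Hil n →L[ℂ] Hil n) ξ)‖ ≤
      (∫ x, B x ∂μ) * (‖η‖ * ‖ξ‖) := by
    intro ξ η
    refine le_of_tendsto_of_tendsto' (b := atTop) ?_ ?_ (fun S => hfin S ξ η)
    · exact ((htr η).inner (((g : Hil n →L[ℂ] Hil n).continuous.tendsto ξ).comp (htr ξ))).norm
    · exact (((htr η).norm).mul (htr ξ).norm).const_mul _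
  refine ContinuousLinearMap.opNorm_le_bound _ hB0 fun ξ => ?_
  -- Testing against `η = g ξ` recovers the operator norm from the bound on the sesquilinear form.
  have h := hall ξ ((g : Hil n →L[ℂ] Hil n) ξ)
  rw [inner_self_eq_norm_sq_to_K, norm_pow, RCLike.norm_ofReal, abs_norm] at h
  by_cases h0 : ‖(g : Hil n →L[ℂ] Hil n) ξ‖ = 0
  · change ‖(g : Hil n →L[ℂ] Hil n) ξ‖ ≤ _
    rw [h0]; positivity
  · have hpos : 0 < ‖(g : Hil n →L[ℂ] Hil n) ξ‖ := lt_of_le_of_ne (norm_nonneg _) (Ne.symm h0)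
    refine le_of_mul_le_mul_left ?_ hpos
    change ‖(g : Hil n →L[ℂ] Hil n) ξ‖ * ‖(g : Hil n →L[ℂ] Hil n) ξ‖ ≤ _
    linarith

/-- Elements of `A_Θ` are determined by their matrix coefficients. -/
lemma ext_coef (Θ : Matrix (Fin n) (Fin n) ℝ) {f g : QT Θ}
    (h : ∀ l k, coef Θ l k f = coef Θ l k g) : f = g := by
  -- Over the zero measure, the inequality says that an element with vanishing coefficients has norm
  -- at most zero.
  have := norm_le_integral_of_coef_eq Θ (μ := (0 : Measure Unit)) (g := f - g) (F := fun _ => 0)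
    (B := fun _ => 0) (by simp) (by simp) (fun l k => aestronglyMeasurable_zero_measure _)
    (fun l k => by simp [h l k])
  rw [integral_zero_measure, norm_le_zero_iff] at this
  exact sub_eq_zero.1 this

end Coefficients

/-! ### Scalar integrals behind the subordination formula -/

section Subordination

open Set Real

lemma hasDerivAt_sub_div (b : ℝ) {u : ℝ} (hu : u ≠ 0) :
    HasDerivAt (fun u : ℝ => u - b / u) (1 + b / u ^ 2) u := by
  refine ((hasDerivAt_id u).sub ((hasDerivAt_inv hu).const_mul b)).congr_deriv ?_
  ring

lemma strictMonoOn_sub_div {b : ℝ} (hb : 0 < b) :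
    StrictMonoOn (fun u : ℝ => u - b / u) (Ioi 0) := by
  intro u hu v _ huv
  have : b / v < b / u := div_lt_div_of_pos_left hb hu huv
  change u - b / u < v - b / v
  linarith

lemma image_sub_div {b : ℝ} (hb : 0 < b) :
    (fun u : ℝ => u - b / u) '' Ioi 0 = univ := by
  refine eq_univ_of_forall fun v => ?_
  have h0 : √(v ^ 2) < √(v ^ 2 + 4 * b) := sqrt_lt_sqrt (sq_nonneg _) (by linarith)
  rw [sqrt_sq_eq_abs] at h0
  have hpos : 0 < v + √(v ^ 2 + 4 * b) := by linarith [neg_abs_le v]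
  -- The preimage of `v` is the positive root of `u² - v u - b = 0`.
  refine ⟨(v + √(v ^ 2 + 4 * b)) / 2, by rw [mem_Ioi]; linarith, ?_⟩
  have h1 : √(v ^ 2 + 4 * b) ^ 2 = v ^ 2 + 4 * b := sq_sqrt (by positivity)
  field_simp
  linear_combination h1

lemma image_div_Ioi {b : ℝ} (hb : 0 < b) : (fun u : ℝ => b / u) '' Ioi 0 = Ioi 0 := by
  ext v
  constructor
  · rintro ⟨u, hu, rfl⟩
    exact div_pos hb hu
  · intro hv
    exact ⟨b / v, div_pos hb hv, div_div_cancel₀ hb.ne'⟩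

lemma injOn_div_Ioi {b : ℝ} (hb : 0 < b) : InjOn (fun u : ℝ => b / u) (Ioi 0) := by
  intro u _ v _ h
  exact inv_injective (mul_left_cancel₀ hb.ne' (by simpa only [div_eq_mul_inv] using h))

lemma hasDerivAt_const_div (b : ℝ) {u : ℝ} (hu : u ≠ 0) :
    HasDerivAt (fun u : ℝ => b / u) (-(b / u ^ 2)) u := by
  refine ((hasDerivAt_inv hu).const_mul b).congr_deriv ?_
  ring

/-- The subordination weight `exp (-u² - b²/u²)`. -/
noncomputable def subWeight (b u : ℝ) : ℝ := exp (-u ^ 2 - b ^ 2 / u ^ 2)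

lemma subWeight_pos (b u : ℝ) : 0 < subWeight b u := exp_pos _

/-- Completing the square, `u² + b²/u² = (u - b/u)² + 2b`; this prepares the substitution `v = u -
b/u`. -/
lemma subWeight_eq (b : ℝ) {u : ℝ} (hu : u ≠ 0) :
    subWeight b u = exp (-2 * b) * exp (-1 * (u - b / u) ^ 2) := by
  rw [subWeight, ← exp_add]
  congr 1
  field_simp
  ring

lemma subWeight_div {b : ℝ} (hb : b ≠ 0) {u : ℝ} (hu : u ≠ 0) :
    subWeight b (b / u) = subWeight b u := by
  unfold subWeight
  congr 1
  field_simp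
  ring

lemma subWeight_le (b u : ℝ) : subWeight b u ≤ exp (-1 * u ^ 2) := by
  unfold subWeight
  refine exp_le_exp.2 ?_
  have : 0 ≤ b ^ 2 / u ^ 2 := by positivity
  linarith

lemma measurable_subWeight (b : ℝ) : Measurable (subWeight b) := by
  unfold subWeight
  fun_prop

/-- The factor `exp (-u²)` handles infinity and `p > -1` handles the origin. The exponent `p = -α`
is used later, which is one place where `α < 1` enters. -/
lemma integrableOn_rpow_mul_subWeight (b : ℝ) {p : ℝ} (hp : -1 < p) :
    IntegrableOn (fun u => u ^ p * subWeight b u) (Ioi 0) := by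
  refine (integrableOn_rpow_mul_exp_neg_mul_sq one_pos hp).mono'
    (by have := measurable_subWeight b; fun_prop) ?_
  filter_upwards [ae_restrict_mem measurableSet_Ioi] with u hu
  have hu : (0 : ℝ) < u := hu
  rw [norm_mul, norm_of_nonneg (rpow_nonneg hu.le _), norm_of_nonneg (subWeight_pos b u).le]
  exact mul_le_mul_of_nonneg_left (subWeight_le b u) (rpow_nonneg hu.le _)

lemma integrableOn_subWeight (b : ℝ) : IntegrableOn (subWeight b) (Ioi 0) := by
  simpa using integrableOn_rpow_mul_subWeight b (p := 0) (by norm_num)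

lemma integrableOn_sq_mul_subWeight (b : ℝ) :
    IntegrableOn (fun u => u ^ 2 * subWeight b u) (Ioi 0) := by
  simpa using integrableOn_rpow_mul_subWeight b (p := 2) (by norm_num)

lemma integrableOn_div_sq_mul_subWeight {b : ℝ} (hb : 0 < b) :
    IntegrableOn (fun u => b / u ^ 2 * subWeight b u) (Ioi 0) := by
  have h := (integrableOn_image_iff_integrableOn_abs_deriv_smul measurableSet_Ioi
    (fun u (hu : 0 < u) => (hasDerivAt_const_div b hu.ne').hasDerivWithinAt)
    (injOn_div_Ioi hb) (subWeight b)).1 (by rw [image_div_Ioi hb]; exact integrableOn_subWeight b)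
  refine h.congr_fun (fun u (hu : 0 < u) => ?_) measurableSet_Ioi
  change |-(b / u ^ 2)| • subWeight b (b / u) = _
  rw [abs_neg, abs_of_pos (by positivity), subWeight_div hb.ne' hu.ne', smul_eq_mul]

/-- The inversion `u ↦ b/u` preserves the weight and has Jacobian `b/u²` in absolute value. -/
lemma integral_div_sq_mul_subWeight {b : ℝ} (hb : 0 < b) :
    ∫ u in Ioi 0, b / u ^ 2 * subWeight b u = ∫ u in Ioi 0, subWeight b u := by
  have h := integral_image_eq_integral_abs_deriv_smul measurableSet_Ioi
    (fun u (hu : 0 < u) => (hasDerivAt_const_div b hu.ne').hasDerivWithinAt)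
    (injOn_div_Ioi hb) (subWeight b)
  rw [image_div_Ioi hb] at h
  rw [h]
  refine setIntegral_congr_fun measurableSet_Ioi fun u (hu : 0 < u) => ?_
  change _ = |-(b / u ^ 2)| • subWeight b (b / u)
  rw [abs_neg, abs_of_pos (by positivity), subWeight_div hb.ne' hu.ne', smul_eq_mul]

/-- The map `v = u - b/u` carries the half-line onto `ℝ` with Jacobian `1 + b/u²`. The two summands
of the Jacobian contribute equally by inversion, so twice the integral is `exp (-2b)` times the full
Gaussian integral. -/
theorem integral_subWeight {b : ℝ} (hb : 0 ≤ b) :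
    ∫ u in Ioi 0, subWeight b u = √π / 2 * exp (-2 * b) := by
  rcases hb.eq_or_lt with rfl | hb
  · have := integral_gaussian_Ioi 1
    simp only [div_one] at this
    simp [subWeight, ← this]
  · have h := integral_image_eq_integral_abs_deriv_smul measurableSet_Ioi
      (fun u (hu : 0 < u) => (hasDerivAt_sub_div b hu.ne').hasDerivWithinAt)
      (strictMonoOn_sub_div hb).injOn (fun v => exp (-1 * v ^ 2))
    rw [image_sub_div hb, setIntegral_univ, integral_gaussian, div_one] at h
    have h2 : exp (-2 * b) * ∫ u in Ioi 0, |1 + b / u ^ 2| • exp (-1 * (u - b / u) ^ 2) =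
        ∫ u in Ioi 0, (subWeight b u + b / u ^ 2 * subWeight b u) := by
      rw [← integral_const_mul]
      refine setIntegral_congr_fun measurableSet_Ioi fun u (hu : 0 < u) => ?_
      change _ * (|1 + b / u ^ 2| * _) = _
      rw [abs_of_pos (by positivity), subWeight_eq b hu.ne']
      ring
    rw [← h, integral_add (integrableOn_subWeight b) (integrableOn_div_sq_mul_subWeight hb),
      integral_div_sq_mul_subWeight hb] at h2
    linarith

/-- The function `u * subWeight b u` vanishes at both ends of the half-line, so its derivative
integrates to zero. That derivative is the integrand here plus `2b` times the inversion integrand,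
whose integral is known. At `b = 0` the value is zero, the cancellation that later allows `f` to be
subtracted. -/
theorem integral_one_sub_mul_subWeight {b : ℝ} (hb : 0 ≤ b) :
    ∫ u in Ioi 0, (1 - 2 * u ^ 2) * subWeight b u = -(b * √π * exp (-2 * b)) := by
  have hint1 : IntegrableOn (fun u => (1 - 2 * u ^ 2) * subWeight b u) (Ioi 0) := by
    refine ((integrableOn_subWeight b).sub
      ((integrableOn_sq_mul_subWeight b).const_mul 2)).congr_fun (fun u _ => ?_) measurableSet_Ioi
    simp only [Pi.sub_apply]
    ring
  have hint2 : IntegrableOn (fun u => b / u ^ 2 * subWeight b u) (Ioi 0) := by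
    rcases hb.eq_or_lt with rfl | hb
    · simp
    · exact integrableOn_div_sq_mul_subWeight hb
  have h := integral_Ioi_of_hasDerivAt_of_tendsto (a := 0) (m := 0)
    (f := fun u => u * subWeight b u)
    (f' := fun u => (1 - 2 * u ^ 2) * subWeight b u + 2 * b * (b / u ^ 2 * subWeight b u))
    ?_ ?_ (hint1.add (hint2.const_mul _)) ?_
  · rw [integral_add hint1 (hint2.const_mul _), integral_const_mul, zero_mul, sub_zero] at h
    rcases hb.eq_or_lt with rfl | hb
    · simpa using h
    · rw [integral_div_sq_mul_subWeight hb, integral_subWeight hb.le] at h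
      linarith
  · refine ContinuousAt.continuousWithinAt ?_
    rw [ContinuousAt, zero_mul]
    refine squeeze_zero_norm (a := fun u => |u|) (fun u => ?_) ?_
    · rw [norm_mul, norm_of_nonneg (subWeight_pos b u).le, norm_eq_abs]
      refine mul_le_of_le_one_right (abs_nonneg _) ((subWeight_le b u).trans ?_)
      exact exp_le_one_iff.2 (by nlinarith [sq_nonneg u])
    · simpa using (continuous_abs (G := ℝ)).tendsto 0
  · intro u (hu : 0 < u)
    have h1 : HasDerivAt (fun u : ℝ => -u ^ 2 - b ^ 2 / u ^ 2) (-2 * u + 2 * b ^ 2 / u ^ 3) u := by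
      refine ((hasDerivAt_pow 2 u).neg.sub
        (((hasDerivAt_pow 2 u).inv (by positivity)).const_mul (b ^ 2))).congr_deriv ?_
      field_simp
      ring
    refine ((hasDerivAt_id u).mul h1.exp).congr_deriv ?_
    unfold subWeight
    simp only [id]
    field_simp
    ring
  · refine squeeze_zero_norm' (a := fun u : ℝ => u ^ (1 : ℝ) * exp (-1 * u)) ?_
      (tendsto_rpow_mul_exp_neg_mul_atTop_nhds_zero 1 1 one_pos)
    filter_upwards [Filter.eventually_ge_atTop 1] with u hu
    rw [norm_mul, norm_of_nonneg (subWeight_pos b u).le, norm_of_nonneg (by linarith), rpow_one]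
    refine mul_le_mul_of_nonneg_left ((subWeight_le b u).trans (exp_le_exp.2 ?_)) (by linarith)
    nlinarith

end Subordination

/-! ### The heat semigroup as a Gaussian average of translations -/

section Gaussian

variable {n : ℕ}

open UnitAddTorus (mFourier)
open ProbabilityTheory (gaussianReal)

/-- The quotient map `ℝⁿ → 𝕋ⁿ`. -/
def toTorus (y : Fin n → ℝ) : UnitAddTorus (Fin n) := fun i => (y i : UnitAddCircle)

lemma continuous_toTorus : Continuous (toTorus (n := n)) :=
  continuous_pi fun i => (AddCircle.continuous_mk' 1).comp (continuous_apply i)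

lemma toTorus_add (y w : Fin n → ℝ) : toTorus (y + w) = toTorus y + toTorus w := rfl

lemma mFourier_toTorus (k : Fin n → ℤ) (y : Fin n → ℝ) :
    mFourier k (toTorus y) = ∏ i, Complex.exp (2 * Real.pi * Complex.I * k i * y i) := by
  simp only [mFourier, ContinuousMap.coe_mk, toTorus]
  exact Finset.prod_congr rfl fun i _ => by rw [fourier_coe_apply]; simp

lemma exists_toTorus_eq (z : UnitAddTorus (Fin n)) :
    ∃ a : Fin n → ℝ, toTorus a = z ∧ ∀ i, |a i| = ‖z i‖ := by
  have h : ∀ i, ∃ x : ℝ, (x : UnitAddCircle) = z i ∧ |x| = ‖z i‖ := by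
    intro i
    obtain ⟨x, hx⟩ := QuotientAddGroup.mk_surjective (z i)
    have hx : (x : UnitAddCircle) = z i := hx
    -- Subtracting the nearest integer gives the shortest lift of the coordinate.
    refine ⟨x - round x, ?_, ?_⟩
    · rw [← hx, AddCircle.coe_sub]
      have : ((round x : ℝ) : UnitAddCircle) = 0 := by
        rw [AddCircle.coe_eq_zero_iff]
        exact ⟨round x, by simp⟩
      rw [this, sub_zero]
    · rw [← hx, UnitAddCircle.norm_eq]
  choose a ha using h
  exact ⟨a, funext fun i => (ha i).1, fun i => (ha i).2⟩

lemma torusAbs_nonneg (z : UnitAddTorus (Fin n)) : 0 ≤ torusAbs z := Real.sqrt_nonneg _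

lemma norm_apply_le_torusAbs (z : UnitAddTorus (Fin n)) (i : Fin n) : ‖z i‖ ≤ torusAbs z :=
  Real.le_sqrt_of_sq_le
    (Finset.single_le_sum (f := fun i => ‖z i‖ ^ 2) (fun _ _ => sq_nonneg _) (Finset.mem_univ i))

/-- The `ℓ¹` norm is a crude majorant, chosen because its Gaussian expectation needs only first
moments of the coordinates. -/
lemma torusAbs_toTorus_le (y : Fin n → ℝ) : torusAbs (toTorus y) ≤ ∑ i, |y i| := by
  have hle : ∀ i, ‖toTorus y i‖ ≤ |y i| := by
    intro i
    change ‖(y i : UnitAddCircle)‖ ≤ _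
    rw [UnitAddCircle.norm_eq]
    simpa using round_le (y i) 0
  refine Real.sqrt_le_iff.2 ⟨Finset.sum_nonneg fun _ _ => abs_nonneg _, ?_⟩
  calc ∑ i, ‖toTorus y i‖ ^ 2 ≤ ∑ i, |y i| ^ 2 :=
        Finset.sum_le_sum fun i _ => pow_le_pow_left₀ (norm_nonneg _) (hle i) 2
    _ ≤ (∑ i, |y i|) ^ 2 := Finset.sum_sq_le_sq_sum_of_nonneg fun _ _ => abs_nonneg _

/-- The law of a centred Gaussian vector in `ℝⁿ` with covariance `2`. -/
noncomputable def gaussianVec (n : ℕ) : Measure (Fin n → ℝ) :=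
  Measure.pi fun _ => gaussianReal 0 2

instance isProbabilityMeasure_gaussianVec (n : ℕ) : IsProbabilityMeasure (gaussianVec n) := by
  unfold gaussianVec
  infer_instance

/-- Variance 2 makes the characteristic function exactly `exp (-ξ²)`; at `ξ = 2π kᵢ √t` this is a
factor of the heat multiplier. -/
lemma integral_exp_gaussian (ξ : ℝ) :
    ∫ x : ℝ, Complex.exp (ξ * x * Complex.I) ∂(gaussianReal 0 2) = Complex.exp (-ξ ^ 2) := by
  rw [← charFun_apply_real, ProbabilityTheory.charFun_gaussianReal]
  congr 1
  push_cast
  ring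

/-- Differentiating the characteristic function in `ξ` brings down the factor `i x`. -/
lemma integral_id_mul_exp_gaussian (ξ : ℝ) :
    ∫ x : ℝ, x * Complex.exp (ξ * x * Complex.I) ∂(gaussianReal 0 2) =
      2 * Complex.I * ξ * Complex.exp (-ξ ^ 2) := by
  have h1 := iteratedDeriv_charFun (n := 1) (t := ξ) (μ := gaussianReal 0 2)
    (by simpa using ProbabilityTheory.memLp_id_gaussianReal (μ := 0) (v := 2) 1)
  have h2 : charFun (gaussianReal 0 2) = fun ξ : ℝ => Complex.exp (-(ξ : ℂ) ^ 2) := by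
    funext ξ
    rw [charFun_apply_real, integral_exp_gaussian]
  have h3 : HasDerivAt (fun ξ : ℝ => Complex.exp (-(ξ : ℂ) ^ 2))
      (-(2 * ξ) * Complex.exp (-(ξ : ℂ) ^ 2)) ξ := by
    have h4 : HasDerivAt (fun ξ : ℂ => Complex.exp (-ξ ^ 2))
        (-(2 * (ξ : ℂ)) * Complex.exp (-(ξ : ℂ) ^ 2)) (ξ : ℂ) := by
      refine ((hasDerivAt_pow 2 (ξ : ℂ)).neg.cexp).congr_deriv ?_
      simp [mul_comm]
    exact h4.comp_ofReal
  rw [iteratedDeriv_one, h2, h3.deriv] at h1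
  simp only [pow_one] at h1
  have h5 := congrArg (fun w => -Complex.I * w) h1
  simp only [← mul_assoc, neg_mul, Complex.I_mul_I, neg_neg, one_mul] at h5
  rw [← h5]
  ring

lemma exp_neg_mul_laplaceEig (k : Fin n → ℤ) {t : ℝ} (ht : 0 ≤ t) :
    (Real.exp (-t * laplaceEig k) : ℂ) =
      ∏ i, Complex.exp (-((2 * Real.pi * k i * √t : ℝ) : ℂ) ^ 2) := by
  rw [← Complex.exp_sum, Complex.ofReal_exp]
  congr 1
  norm_cast
  rw [Finset.sum_neg_distrib, neg_mul, laplaceEig, Finset.mul_sum, Finset.mul_sum]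
  congr 1
  refine Finset.sum_congr rfl fun i _ => ?_
  rw [mul_pow, Real.sq_sqrt ht]
  ring

lemma mFourier_toTorus_sqrt_smul (k : Fin n → ℤ) (t : ℝ) (y : Fin n → ℝ) :
    mFourier k (toTorus (√t • y)) =
      ∏ i, Complex.exp ((2 * Real.pi * k i * √t : ℝ) * y i * Complex.I) := by
  rw [mFourier_toTorus]
  refine Finset.prod_congr rfl fun i _ => ?_
  congr 1
  simp only [Pi.smul_apply, smul_eq_mul]
  push_cast
  ring

/-- This is the identity `T_t = 𝔼 σ_{√t Y}` at one frequency. It replaces pointwise information on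
the heat kernel, such as its positivity. -/
lemma integral_mFourier_gaussianVec (k : Fin n → ℤ) {t : ℝ} (ht : 0 ≤ t) :
    ∫ y, mFourier k (toTorus (√t • y)) ∂(gaussianVec n) = Real.exp (-t * laplaceEig k) := by
  simp only [mFourier_toTorus_sqrt_smul]
  rw [gaussianVec, integral_fintype_prod_eq_prod (𝕜 := ℂ)
    (fun (i : Fin n) (x : ℝ) => Complex.exp ((2 * Real.pi * k i * √t : ℝ) * x * Complex.I)),
    exp_neg_mul_laplaceEig k ht]
  simp only [integral_exp_gaussian]

/-- Gaussian integration by parts at one frequency: weighting the average by a coordinate of `Y`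
amounts to differentiating the heat multiplier in that direction, up to the factor `2√t`. -/
lemma integral_coord_mul_mFourier_gaussianVec (k : Fin n → ℤ) {t : ℝ} (ht : 0 ≤ t)
    (j : Fin n) :
    ∫ y, (y j : ℂ) * mFourier k (toTorus (√t • y)) ∂(gaussianVec n) =
      4 * Real.pi * Complex.I * k j * √t * Real.exp (-t * laplaceEig k) := by
  -- The factor `y j` is absorbed into the `j`-th slot so that the integrand stays a product over
  -- coordinates.
  have h1 : ∀ y : Fin n → ℝ, (y j : ℂ) * mFourier k (toTorus (√t • y)) =
      ∏ i, ((if i = j then (y i : ℂ) else 1) *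
        Complex.exp ((2 * Real.pi * k i * √t : ℝ) * y i * Complex.I)) := by
    intro y
    rw [Finset.prod_mul_distrib, Finset.prod_ite_eq' Finset.univ j, mFourier_toTorus_sqrt_smul]
    simp
  simp only [h1]
  rw [gaussianVec, integral_fintype_prod_eq_prod (𝕜 := ℂ)
    (fun (i : Fin n) (x : ℝ) => (if i = j then (x : ℂ) else 1) *
      Complex.exp ((2 * Real.pi * k i * √t : ℝ) * x * Complex.I)),
    exp_neg_mul_laplaceEig k ht]
  have h2 : ∀ i, (∫ x : ℝ, (if i = j then (x : ℂ) else 1) *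
      Complex.exp ((2 * Real.pi * k i * √t : ℝ) * x * Complex.I) ∂(gaussianReal 0 2)) =
      (if i = j then 4 * Real.pi * Complex.I * k i * √t else 1) *
        Complex.exp (-((2 * Real.pi * k i * √t : ℝ) : ℂ) ^ 2) := by
    intro i
    split_ifs with h
    · rw [integral_id_mul_exp_gaussian]
      push_cast
      ring
    · simp only [one_mul, integral_exp_gaussian]
  simp only [h2]
  rw [Finset.prod_mul_distrib, Finset.prod_ite_eq' Finset.univ j]
  simp

lemma integrable_coord_gaussianVec (i : Fin n) :
    Integrable (fun y : Fin n → ℝ => y i) (gaussianVec n) := by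
  have h : Integrable (id : ℝ → ℝ) (gaussianReal 0 2) :=
    memLp_one_iff_integrable.1
      (by simpa using ProbabilityTheory.memLp_id_gaussianReal (μ := 0) (v := 2) 1)
  exact (measurePreserving_eval (fun _ : Fin n => gaussianReal 0 2) i).integrable_comp_of_integrable h

/-- The moment `1 + 𝔼 ∑ᵢ |Yᵢ|` of the Gaussian vector. -/
noncomputable def gaussianMoment (n : ℕ) : ℝ := ∫ y, (1 + ∑ i, |y i|) ∂(gaussianVec n)

lemma integrable_one_add_sum_abs :
    Integrable (fun y : Fin n → ℝ => 1 + ∑ i, |y i|) (gaussianVec n) :=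
  (integrable_const 1).add
    (integrable_finsetSum _ fun i _ => (integrable_coord_gaussianVec i).abs)

lemma gaussianMoment_nonneg (n : ℕ) : 0 ≤ gaussianMoment n :=
  integral_nonneg fun _ => add_nonneg zero_le_one (Finset.sum_nonneg fun _ _ => abs_nonneg _)

lemma continuous_coef_translation (Θ : Matrix (Fin n) (Fin n) ℝ) (l k : Fin n → ℤ)
    (f : QT Θ) : Continuous fun z => coef Θ l k (translation Θ z f) := by
  simp only [coef_translation]
  exact (mFourier (l - k)).continuous.mul continuous_const

/-- The heat semigroup moves a Hölder element by at most a multiple of `t^{α/2}`. -/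
theorem norm_heat_sub_le (Θ : Matrix (Fin n) (Fin n) ℝ) {α M : ℝ} (hα₀ : 0 ≤ α) (hα₁ : α ≤ 1)
    (hM : 0 ≤ M) {f : QT Θ} (hf : ∀ z, ‖translation Θ z f - f‖ ≤ M * torusAbs z ^ α) {t : ℝ}
    (ht : 0 < t) : ‖heat Θ t f - f‖ ≤ M * √t ^ α * gaussianMoment n := by
  have hcont : Continuous fun y : Fin n → ℝ => toTorus (√t • y) :=
    continuous_toTorus.comp (continuous_const_smul _)
  rw [gaussianMoment, ← integral_const_mul]
  refine norm_le_integral_of_coef_eq Θ (F := fun y => translation Θ (toTorus (√t • y)) f - f)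
    (integrable_one_add_sum_abs.const_mul _) (Filter.Eventually.of_forall fun y => ?_) ?_ ?_
  · have hS : 0 ≤ ∑ i, |y i| := Finset.sum_nonneg fun _ _ => abs_nonneg _
    have h1 : torusAbs (toTorus (√t • y)) ≤ √t * ∑ i, |y i| := by
      refine (torusAbs_toTorus_le _).trans (le_of_eq ?_)
      simp only [Pi.smul_apply, smul_eq_mul, abs_mul, abs_of_nonneg (Real.sqrt_nonneg t),
        Finset.mul_sum]
    -- This is why the moment carries the summand `1`: it dominates the `α`-th power for all `α` in
    -- `[0, 1]` at once.
    have h2 : (∑ i, |y i|) ^ α ≤ 1 + ∑ i, |y i| := by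
      calc (∑ i, |y i|) ^ α ≤ (1 + ∑ i, |y i|) ^ α :=
            Real.rpow_le_rpow hS (by linarith) hα₀
        _ ≤ (1 + ∑ i, |y i|) ^ (1 : ℝ) := Real.rpow_le_rpow_of_exponent_le (by linarith) hα₁
        _ = _ := Real.rpow_one _
    calc _ ≤ M * torusAbs (toTorus (√t • y)) ^ α := hf _
      _ ≤ M * (√t * ∑ i, |y i|) ^ α := by
          gcongr
          exact torusAbs_nonneg _
      _ = M * √t ^ α * (∑ i, |y i|) ^ α := by
          rw [Real.mul_rpow (Real.sqrt_nonneg _) hS, mul_assoc]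
      _ ≤ _ := by gcongr
  · intro l k
    simp only [map_sub]
    exact (((continuous_coef_translation Θ l k f).comp hcont).sub
      continuous_const).aestronglyMeasurable
  · intro l k
    have hint : Integrable (fun y : Fin n → ℝ => mFourier (l - k) (toTorus (√t • y)))
        (gaussianVec n) := by
      refine Integrable.of_bound ((mFourier (l - k)).continuous.comp hcont).aestronglyMeasurable 1
        (Filter.Eventually.of_forall fun y => (norm_mFourier_apply _ _).le)
    simp only [map_sub, coef_heat Θ ht, coef_translation]
    rw [integral_sub (hint.mul_const _) (integrable_const _), integral_mul_const,
      integral_mFourier_gaussianVec _ ht.le]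
    simp

/-- Keeping `w` inside the integral avoids a division and covers `w = 0`. -/
lemma integral_mul_exp_mul_unit (w : ℂ) :
    ∫ θ in Set.Ioc (0 : ℝ) 1, w * Complex.exp (w * θ) = Complex.exp w - 1 := by
  rw [← intervalIntegral.integral_of_le zero_le_one]
  have h : ∀ θ : ℝ, HasDerivAt (fun θ : ℝ => Complex.exp (w * θ)) (w * Complex.exp (w * θ)) θ := by
    intro θ
    have h1 : HasDerivAt (fun θ : ℂ => Complex.exp (w * θ)) (w * Complex.exp (w * θ)) (θ : ℂ) := by
      refine ((hasDerivAt_id (θ : ℂ)).const_mul w).cexp.congr_deriv ?_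
      simp [mul_comm]
    exact h1.comp_ofReal
  rw [intervalIntegral.integral_eq_sub_of_hasDerivAt (fun θ _ => h θ)
    (Continuous.intervalIntegrable (by fun_prop) _ _)]
  simp

lemma mFourier_toTorus_smul (k : Fin n → ℤ) (θ : ℝ) (a : Fin n → ℝ) :
    mFourier k (toTorus (θ • a)) =
      Complex.exp ((2 * Real.pi * Complex.I * ∑ i, (k i : ℂ) * a i) * θ) := by
  rw [mFourier_toTorus, ← Complex.exp_sum, Finset.mul_sum, Finset.sum_mul]
  congr 1
  refine Finset.sum_congr rfl fun i _ => ?_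
  simp only [Pi.smul_apply, smul_eq_mul]
  push_cast
  ring

/-- The gradient bound for the heat semigroup. -/
theorem norm_translation_heat_sub_le (Θ : Matrix (Fin n) (Fin n) ℝ) (z : UnitAddTorus (Fin n))
    (g : QT Θ) {t : ℝ} (ht : 0 < t) :
    ‖translation Θ z (heat Θ t g) - heat Θ t g‖ ≤
      (2 * √t)⁻¹ * (n * torusAbs z) * ‖g‖ * gaussianMoment n := by
  obtain ⟨a, rfl, ha⟩ := exists_toTorus_eq z
  set A := torusAbs (toTorus a)
  have hA : 0 ≤ A := torusAbs_nonneg _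
  have haA : ∀ i, |a i| ≤ A := fun i => (ha i).le.trans (norm_apply_le_torusAbs _ i)
  have hst : 0 < √t := Real.sqrt_pos.2 ht
  have hcont : Continuous fun p : ℝ × (Fin n → ℝ) => toTorus (p.1 • a + √t • p.2) :=
    continuous_toTorus.comp (by fun_prop)
  have hB : ∫ p : ℝ × (Fin n → ℝ), (2 * √t)⁻¹ * (n * A) * ‖g‖ * (1 + ∑ i, |p.2 i|)
      ∂((volume.restrict (Set.Ioc (0 : ℝ) 1)).prod (gaussianVec n)) =
      (2 * √t)⁻¹ * (n * A) * ‖g‖ * gaussianMoment n := by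
    rw [integral_const_mul, gaussianMoment]
    congr 1
    rw [integral_fun_snd (μ := volume.restrict (Set.Ioc (0 : ℝ) 1)) (ν := gaussianVec n)
      (fun y : Fin n → ℝ => 1 + ∑ i, |y i|)]
    simp
  rw [← hB]
  -- The integrand comes from moving along the segment `θ a`, `0 < θ ≤ 1`, to `z`, with the
  -- directional derivative of the Gaussian average put on the Gaussian density; that yields the
  -- weight `⟨a, Y⟩ / (2√t)`.
  refine norm_le_integral_of_coef_eq Θ
    (F := fun p : ℝ × (Fin n → ℝ) => (((2 * √t)⁻¹ * ∑ i, a i * p.2 i : ℝ) : ℂ) •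
      translation Θ (toTorus (p.1 • a + √t • p.2)) g)
    ((integrable_one_add_sum_abs.comp_snd _).const_mul _)
    (Filter.Eventually.of_forall fun p => ?_) ?_ ?_
  · rw [norm_smul, Complex.norm_real, Real.norm_eq_abs, abs_mul, abs_of_pos (by positivity)]
    have h1 : |∑ i, a i * p.2 i| ≤ n * A * (1 + ∑ i, |p.2 i|) := by
      have h2 : ∀ i, |a i * p.2 i| ≤ A * (1 + ∑ i, |p.2 i|) := by
        intro i
        have h3 : |p.2 i| ≤ ∑ i, |p.2 i| :=
          Finset.single_le_sum (f := fun i => |p.2 i|) (fun _ _ => abs_nonneg _)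
            (Finset.mem_univ i)
        rw [abs_mul]
        exact mul_le_mul (haA i) (by linarith) (abs_nonneg _) hA
      refine (Finset.abs_sum_le_sum_abs _ _).trans ((Finset.sum_le_sum fun i _ => h2 i).trans ?_)
      simp [mul_assoc]
    calc _ ≤ (2 * √t)⁻¹ * (n * A * (1 + ∑ i, |p.2 i|)) * ‖g‖ :=
          mul_le_mul (by gcongr) (norm_translation_le _ _ _) (norm_nonneg _)
            (mul_nonneg (by positivity) ((abs_nonneg _).trans h1))
      _ = _ := by ring
  · intro l k
    simp only [map_smul, smul_eq_mul]
    exact (Continuous.mul (by fun_prop)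
      ((continuous_coef_translation Θ l k g).comp hcont)).aestronglyMeasurable
  · intro l k
    set m := l - k with hm
    set w : ℂ := 2 * Real.pi * Complex.I * ∑ i, (m i : ℂ) * a i with hw
    have hint : ∀ i, Integrable (fun y : Fin n → ℝ => (y i : ℂ) * mFourier m (toTorus (√t • y)))
        (gaussianVec n) := fun i =>
      ((integrable_coord_gaussianVec i).ofReal (𝕜 := ℂ)).mul_bdd (c := 1)
        ((mFourier m).continuous.comp
          (continuous_toTorus.comp (continuous_const_smul _))).aestronglyMeasurable
        (Filter.Eventually.of_forall fun y => (norm_mFourier_apply _ _).le)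
    have h1 : ∀ p : ℝ × (Fin n → ℝ), coef Θ l k ((((2 * √t)⁻¹ * ∑ i, a i * p.2 i : ℝ) : ℂ) •
        translation Θ (toTorus (p.1 • a + √t • p.2)) g) =
        ((2 * √t : ℝ) : ℂ)⁻¹ * coef Θ l k g * (Complex.exp (w * p.1) *
          ∑ i, (a i : ℂ) * ((p.2 i : ℂ) * mFourier m (toTorus (√t • p.2)))) := by
      intro p
      rw [map_smul, smul_eq_mul, coef_translation, toTorus_add, mFourier_apply_add, ← hm,
        mFourier_toTorus_smul, ← hw]
      simp only [← mul_assoc, ← Finset.sum_mul]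
      push_cast
      ring
    simp only [h1]
    rw [integral_const_mul, integral_prod_mul (fun θ : ℝ => Complex.exp (w * θ))
      (fun y : Fin n → ℝ => ∑ i, (a i : ℂ) * ((y i : ℂ) * mFourier m (toTorus (√t • y)))),
      integral_finsetSum _ fun i _ => (hint i).const_mul _]
    simp only [integral_const_mul, integral_coord_mul_mFourier_gaussianVec m ht.le]
    -- The factor `2√t` produced here cancels the normalisation of the weight and leaves `w`, the
    -- derivative of the character along `a`.
    have h2 : ∑ i, (a i : ℂ) * (4 * Real.pi * Complex.I * m i * √t *
        Real.exp (-t * laplaceEig m)) = 2 * √t * Real.exp (-t * laplaceEig m) * w := by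
      rw [hw, Finset.mul_sum, Finset.mul_sum]
      exact Finset.sum_congr rfl fun i _ => by ring
    have h3 := integral_mul_exp_mul_unit w
    rw [integral_const_mul] at h3
    have h4 : mFourier m (toTorus a) = Complex.exp w := by
      simpa [← hw] using mFourier_toTorus_smul m 1 a
    have h5 : ((√t : ℝ) : ℂ) ≠ 0 := by exact_mod_cast hst.ne'
    rw [h2, map_sub, coef_translation, coef_heat Θ ht, ← hm, h4]
    push_cast
    rw [show Complex.exp w * (Complex.exp (-t * laplaceEig m) * coef Θ l k g) -
      Complex.exp (-t * laplaceEig m) * coef Θ l k g =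
      (Complex.exp w - 1) * (Complex.exp (-t * laplaceEig m) * coef Θ l k g) by ring, ← h3]
    field_simp

end Gaussian

/-! ### Estimates between the two Hölder seminorms -/

section HoelderEstimates

variable {n : ℕ}

open UnitAddTorus (mFourier)
open Set

lemma laplaceEig_nonneg (k : Fin n → ℤ) : 0 ≤ laplaceEig k := by unfold laplaceEig; positivity

lemma subWeight_zero (u : ℝ) : subWeight 0 u = Real.exp (-1 * u ^ 2) := by simp [subWeight]

/-- Heat at time `(s/2u)²` against the Gaussian weight is the subordination weight with `b = s √L /
2`, for which `exp (-2b)` is the Poisson multiplier. -/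
lemma subWeight_zero_mul_exp {L : ℝ} (hL : 0 ≤ L) (s u : ℝ) :
    subWeight 0 u * Real.exp (-(s / (2 * u)) ^ 2 * L) = subWeight (s * √L / 2) u := by
  rw [subWeight_zero, subWeight, ← Real.exp_add]
  congr 1
  have h := Real.sq_sqrt hL
  rw [div_pow, div_pow, mul_pow, mul_pow, h]
  ring

lemma integrableOn_one_sub_mul_subWeight (b : ℝ) :
    IntegrableOn (fun u => (1 - 2 * u ^ 2) * subWeight b u) (Ioi 0) := by
  refine ((integrableOn_subWeight b).sub
    ((integrableOn_sq_mul_subWeight b).const_mul 2)).congr_fun (fun u _ => ?_) measurableSet_Ioi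
  simp only [Pi.sub_apply]
  ring

/-- The constant in the estimate of `(d/ds) P_s f` by the translation Hölder seminorm. -/
noncomputable def derivConst (n : ℕ) (α : ℝ) : ℝ :=
  2 / √Real.pi * (1 / 2) ^ α * gaussianMoment n *
    ∫ u in Ioi 0, (u ^ (-α) * subWeight 0 u + 2 * (u ^ (2 - α) * subWeight 0 u))

/-- Differentiating the subordination formula in `s`, in the time variable `t = (s/2u)²`, multiplies
its density by `1/s - s/(2t) = (1 - 2u²)/s`. This weight has mean zero against `exp (-u²)`, so only
`T_t f - f` matters, of size `(s/2u)^α`; with the factor `1/s` this is `s^{α-1} u^{-α}`. -/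
theorem norm_deriv_poisson_le (Θ : Matrix (Fin n) (Fin n) ℝ) {α M : ℝ} (hα₀ : 0 < α)
    (hα₁ : α < 1) (hM : 0 ≤ M) {f : QT Θ}
    (hf : ∀ z, ‖translation Θ z f - f‖ ≤ M * torusAbs z ^ α) {s : ℝ} (hs : 0 < s) :
    ‖deriv (fun r => poisson Θ r f) s‖ ≤ derivConst n α * M * s ^ (α - 1) := by
  have hint : IntegrableOn
      (fun u => u ^ (-α) * subWeight 0 u + 2 * (u ^ (2 - α) * subWeight 0 u)) (Ioi 0) :=
    (integrableOn_rpow_mul_subWeight 0 (by linarith)).add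
      ((integrableOn_rpow_mul_subWeight 0 (by linarith)).const_mul 2)
  have hπ : 0 < √Real.pi := Real.sqrt_pos.2 Real.pi_pos
  have hB : derivConst n α * M * s ^ (α - 1) =
      ∫ u in Ioi 0, (2 / √Real.pi * (1 / 2) ^ α * gaussianMoment n * M * s ^ (α - 1)) *
        (u ^ (-α) * subWeight 0 u + 2 * (u ^ (2 - α) * subWeight 0 u)) := by
    rw [integral_const_mul, derivConst]
    ring
  rw [hB]
  refine norm_le_integral_of_coef_eq Θ
    -- Subtracting `f` costs nothing in the integral, by the cancellation at `b = 0`, and gains the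
    -- factor `s^α`.
    (F := fun u => (((2 / √Real.pi / s) * ((1 - 2 * u ^ 2) * subWeight 0 u) : ℝ) : ℂ) •
      (heat Θ ((s / (2 * u)) ^ 2) f - f)) (hint.const_mul _) ?_ ?_ ?_
  · filter_upwards [ae_restrict_mem measurableSet_Ioi] with u (hu : 0 < u)
    have hsu : 0 < s / (2 * u) := by positivity
    have h1 := norm_heat_sub_le Θ hα₀.le hα₁.le hM hf (pow_pos hsu 2)
    rw [Real.sqrt_sq hsu.le] at h1
    have h2 : (s / (2 * u)) ^ α = (1 / 2) ^ α * s ^ α * u ^ (-α) := by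
      rw [show s / (2 * u) = (1 / 2) * s * u⁻¹ by field_simp, Real.mul_rpow (by positivity)
        (by positivity), Real.mul_rpow (by positivity) hs.le, Real.inv_rpow hu.le,
        Real.rpow_neg hu.le]
    have h3 : s ^ (α - 1) = s ^ α / s := by rw [Real.rpow_sub hs, Real.rpow_one]
    have h4 : u ^ (2 - α) = u ^ 2 * u ^ (-α) := by
      rw [sub_eq_add_neg, Real.rpow_add hu, Real.rpow_two]
    have h5 : |1 - 2 * u ^ 2| ≤ 1 + 2 * u ^ 2 := by
      rw [abs_le]
      constructor <;> nlinarith [sq_nonneg u]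
    have hw := subWeight_pos 0 u
    have hK := gaussianMoment_nonneg n
    rw [norm_smul, Complex.norm_real, Real.norm_eq_abs, abs_mul, abs_mul,
      abs_of_pos (by positivity), abs_of_pos hw]
    calc _ ≤ 2 / √Real.pi / s * ((1 + 2 * u ^ 2) * subWeight 0 u) *
          (M * (s / (2 * u)) ^ α * gaussianMoment n) := by gcongr
      _ = _ := by
          rw [h2, h3, h4]
          field_simp
  · intro l k
    have h : Measurable fun u : ℝ =>
        (((2 / √Real.pi / s) * ((1 - 2 * u ^ 2) * subWeight 0 u) : ℝ) : ℂ) *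
        (Real.exp (-(s / (2 * u)) ^ 2 * laplaceEig (l - k)) * coef Θ l k f - coef Θ l k f) := by
      have := measurable_subWeight 0
      fun_prop
    refine h.aestronglyMeasurable.congr ?_
    filter_upwards [ae_restrict_mem measurableSet_Ioi] with u (hu : 0 < u)
    rw [map_smul, map_sub, coef_heat Θ (by positivity), smul_eq_mul]
  · intro l k
    set L := laplaceEig (l - k) with hLdef
    have hL : 0 ≤ L := laplaceEig_nonneg _
    have h1 : ∫ u in Ioi (0 : ℝ), coef Θ l k
        ((((2 / √Real.pi / s) * ((1 - 2 * u ^ 2) * subWeight 0 u) : ℝ) : ℂ) •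
          (heat Θ ((s / (2 * u)) ^ 2) f - f)) =
        ∫ u in Ioi (0 : ℝ), (((2 / √Real.pi / s) *
          ((1 - 2 * u ^ 2) * subWeight (s * √L / 2) u - (1 - 2 * u ^ 2) * subWeight 0 u) : ℝ) : ℂ) *
            coef Θ l k f := by
      refine setIntegral_congr_fun measurableSet_Ioi fun u (hu : 0 < u) => ?_
      rw [map_smul, map_sub, coef_heat Θ (by positivity), smul_eq_mul,
        ← subWeight_zero_mul_exp hL]
      push_cast
      ring
    rw [h1, integral_mul_const, integral_complex_ofReal, integral_const_mul,
      integral_sub (integrableOn_one_sub_mul_subWeight _) (integrableOn_one_sub_mul_subWeight _),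
      integral_one_sub_mul_subWeight (by positivity), integral_one_sub_mul_subWeight le_rfl,
      coef_deriv_poisson Θ hs, ← hLdef]
    congr 2
    rw [show -2 * (s * √L / 2) = -s * √L by ring]
    field_simp
    ring

/-- The constant in the gradient bound for the Poisson semigroup. -/
noncomputable def gradConst (n : ℕ) : ℝ :=
  2 / √Real.pi * n * gaussianMoment n * ∫ u in Ioi 0, u ^ (1 : ℝ) * subWeight 0 u

lemma gradConst_nonneg (n : ℕ) : 0 ≤ gradConst n := by
  have h1 := gaussianMoment_nonneg n
  have h2 : 0 ≤ ∫ u in Ioi 0, u ^ (1 : ℝ) * subWeight 0 u :=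
    setIntegral_nonneg measurableSet_Ioi fun u (hu : 0 < u) =>
      mul_nonneg (Real.rpow_nonneg hu.le _) (subWeight_pos 0 u).le
  unfold gradConst
  positivity

/-- The gradient bound for the Poisson semigroup. -/
theorem norm_translation_poisson_sub_le (Θ : Matrix (Fin n) (Fin n) ℝ)
    (z : UnitAddTorus (Fin n)) (g : QT Θ) {s : ℝ} (hs : 0 < s) :
    ‖translation Θ z (poisson Θ s g) - poisson Θ s g‖ ≤
      gradConst n * torusAbs z * s⁻¹ * ‖g‖ := by
  have hπ : 0 < √Real.pi := Real.sqrt_pos.2 Real.pi_pos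
  have hB : gradConst n * torusAbs z * s⁻¹ * ‖g‖ =
      ∫ u in Ioi 0, (2 / √Real.pi * n * gaussianMoment n * torusAbs z * s⁻¹ * ‖g‖) *
        (u ^ (1 : ℝ) * subWeight 0 u) := by
    rw [integral_const_mul, gradConst]
    ring
  rw [hB]
  refine norm_le_integral_of_coef_eq Θ
    -- The heat gradient bound at time `(s/2u)²` is proportional to `u/s`, so the integral converges
    -- and leaves `s⁻¹`.
    (F := fun u => ((2 / √Real.pi * subWeight 0 u : ℝ) : ℂ) •
      (translation Θ z (heat Θ ((s / (2 * u)) ^ 2) g) - heat Θ ((s / (2 * u)) ^ 2) g))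
    ((integrableOn_rpow_mul_subWeight 0 (by norm_num)).const_mul _) ?_ ?_ ?_
  · filter_upwards [ae_restrict_mem measurableSet_Ioi] with u (hu : 0 < u)
    have hsu : 0 < s / (2 * u) := by positivity
    have h1 := norm_translation_heat_sub_le Θ z g (pow_pos hsu 2)
    rw [Real.sqrt_sq hsu.le] at h1
    have hw := subWeight_pos 0 u
    rw [norm_smul, Complex.norm_real, Real.norm_eq_abs, abs_of_pos (by positivity)]
    calc _ ≤ _ := mul_le_mul_of_nonneg_left h1 (by positivity)
      _ = _ := by
          rw [Real.rpow_one]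
          field_simp
  · intro l k
    have h : Measurable fun u : ℝ => ((2 / √Real.pi * subWeight 0 u : ℝ) : ℂ) *
        (mFourier (l - k) z *
          (Real.exp (-(s / (2 * u)) ^ 2 * laplaceEig (l - k)) * coef Θ l k g) -
          Real.exp (-(s / (2 * u)) ^ 2 * laplaceEig (l - k)) * coef Θ l k g) := by
      have := measurable_subWeight 0
      fun_prop
    refine h.aestronglyMeasurable.congr ?_
    filter_upwards [ae_restrict_mem measurableSet_Ioi] with u (hu : 0 < u)
    rw [map_smul, map_sub, coef_translation, coef_heat Θ (by positivity), smul_eq_mul]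
  · intro l k
    set L := laplaceEig (l - k) with hLdef
    have hL : 0 ≤ L := laplaceEig_nonneg _
    have h1 : ∫ u in Ioi (0 : ℝ), coef Θ l k (((2 / √Real.pi * subWeight 0 u : ℝ) : ℂ) •
        (translation Θ z (heat Θ ((s / (2 * u)) ^ 2) g) - heat Θ ((s / (2 * u)) ^ 2) g)) =
        ∫ u in Ioi (0 : ℝ), ((2 / √Real.pi * subWeight (s * √L / 2) u : ℝ) : ℂ) *
            ((mFourier (l - k) z - 1) * coef Θ l k g) := by
      refine setIntegral_congr_fun measurableSet_Ioi fun u (hu : 0 < u) => ?_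
      rw [map_smul, map_sub, coef_translation, coef_heat Θ (by positivity), smul_eq_mul,
        ← subWeight_zero_mul_exp hL]
      push_cast
      ring
    rw [h1, integral_mul_const, integral_complex_ofReal, integral_const_mul,
      integral_subWeight (by positivity), map_sub, coef_translation, coef_poisson Θ hs,
      ← hLdef, show -2 * (s * √L / 2) = -s * √L by ring,
      show 2 / √Real.pi * (√Real.pi / 2 * Real.exp (-s * √L)) = Real.exp (-s * √L) by field_simp]
    ring

/-- The semigroup law differentiated, checked on multipliers. One half of the time remains available
for the gradient bound, the other for the hypothesis on the derivative. -/
lemma deriv_poisson_eq_poisson_half (Θ : Matrix (Fin n) (Fin n) ℝ) (f : QT Θ) {s : ℝ}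
    (hs : 0 < s) : deriv (fun r => poisson Θ r f) s =
      poisson Θ (s / 2) (deriv (fun r => poisson Θ r f) (s / 2)) := by
  refine ext_coef Θ fun l k => ?_
  rw [coef_poisson Θ (half_pos hs), coef_deriv_poisson Θ hs, coef_deriv_poisson Θ (half_pos hs),
    ← mul_assoc, ← Complex.ofReal_mul]
  congr 2
  rw [mul_left_comm, ← Real.exp_add]
  congr 2
  ring

lemma continuousOn_coef_deriv_poisson (Θ : Matrix (Fin n) (Fin n) ℝ) (f : QT Θ)
    (l k : Fin n → ℤ) :
    ContinuousOn (fun r => coef Θ l k (deriv (fun r => poisson Θ r f) r)) (Ioi 0) := by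
  refine ContinuousOn.congr (f := fun r : ℝ =>
    ((-√(laplaceEig (l - k)) * Real.exp (-r * √(laplaceEig (l - k))) : ℝ) : ℂ) *
      coef Θ l k f) (by fun_prop) fun r hr => coef_deriv_poisson Θ hr l k f

/-- The difference is minus the integral of the derivative over `(0, s)`, and `r^{α-1}` is
integrable at the origin because `α > 0`. Working on coefficients makes the limit `r → 0` harmless,
although `P_r f` need not be known to converge to `f` in norm. -/
theorem norm_sub_poisson_le (Θ : Matrix (Fin n) (Fin n) ℝ) {α N : ℝ} (hα₀ : 0 < α)
    {f : QT Θ} (hf : ∀ r, 0 < r → ‖deriv (fun r => poisson Θ r f) r‖ ≤ N * r ^ (α - 1))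
    {s : ℝ} (hs : 0 < s) : ‖f - poisson Θ s f‖ ≤ N * (s ^ α / α) := by
  have hB : N * (s ^ α / α) = ∫ r in Ioc 0 s, N * r ^ (α - 1) := by
    rw [integral_const_mul, ← intervalIntegral.integral_of_le hs.le,
      integral_rpow (Or.inl (by linarith)), sub_add_cancel, Real.zero_rpow hα₀.ne', sub_zero]
  rw [hB]
  refine norm_le_integral_of_coef_eq Θ (F := fun r => -deriv (fun r => poisson Θ r f) r)
    (((intervalIntegral.intervalIntegrable_rpow' (by linarith)).1).const_mul _) ?_ ?_ ?_
  · filter_upwards [ae_restrict_mem measurableSet_Ioc] with r hr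
    rw [norm_neg]
    exact hf r hr.1
  · intro l k
    simp only [map_neg]
    exact (((continuousOn_coef_deriv_poisson Θ f l k).mono
      Ioc_subset_Ioi_self).aestronglyMeasurable measurableSet_Ioc).neg
  · intro l k
    have h1 : ∫ r in Ioc 0 s, coef Θ l k (-deriv (fun r => poisson Θ r f) r) =
        ∫ r in Ioc 0 s, ((-(-√(laplaceEig (l - k)) *
          Real.exp (-r * √(laplaceEig (l - k)))) : ℝ) : ℂ) * coef Θ l k f := by
      refine setIntegral_congr_fun measurableSet_Ioc fun r hr => ?_
      rw [map_neg, coef_deriv_poisson Θ hr.1]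
      push_cast
      ring
    rw [h1, integral_mul_const, integral_complex_ofReal, integral_neg,
      ← intervalIntegral.integral_of_le hs.le,
      intervalIntegral.integral_eq_sub_of_hasDerivAt
        (fun r _ => hasDerivAt_exp_neg_mul _ r)
        (Continuous.intervalIntegrable (by fun_prop) _ _), map_sub, coef_poisson Θ hs]
    simp
    ring

lemma integral_exp_neg_mul_Ioi {c : ℝ} (hc : 0 < c) (s : ℝ) :
    ∫ r in Ioi s, -c * Real.exp (-r * c) = -Real.exp (-s * c) := by
  have h := integral_Ioi_of_hasDerivAt_of_nonpos' (a := s) (l := 0)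
    (fun r _ => hasDerivAt_exp_neg_mul c r)
    (fun r _ => mul_nonpos_of_nonpos_of_nonneg (neg_nonpos.2 hc.le) (Real.exp_pos _).le)
    (Real.tendsto_exp_atBot.comp (Filter.tendsto_neg_atTop_atBot.atBot_mul_const hc))
  rw [h, zero_sub]

lemma laplaceEig_pos {k : Fin n → ℤ} (hk : k ≠ 0) : 0 < laplaceEig k := by
  obtain ⟨i, hi⟩ := Function.ne_iff.mp hk
  have h1 : (0 : ℝ) < (k i : ℝ) ^ 2 := by
    have : (k i : ℝ) ≠ 0 := by exact_mod_cast hi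
    positivity
  have h2 : (k i : ℝ) ^ 2 ≤ ∑ i, (k i : ℝ) ^ 2 :=
    Finset.single_le_sum (f := fun i => (k i : ℝ) ^ 2) (fun i _ => sq_nonneg _)
      (Finset.mem_univ i)
  have h3 := Real.pi_pos
  have h4 : 0 < ∑ i, (k i : ℝ) ^ 2 := h1.trans_le h2
  unfold laplaceEig
  positivity

/-- The increment is recovered by integrating its `r`-derivative from `s` to infinity. The gradient
bound improves `r^{α-1}` to `r^{α-2}`, which is integrable at infinity because `α < 1`. -/
theorem norm_translation_poisson_sub_le_of_deriv (Θ : Matrix (Fin n) (Fin n) ℝ) {α N : ℝ}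
    (hα₁ : α < 1) {f : QT Θ}
    (hf : ∀ r, 0 < r → ‖deriv (fun r => poisson Θ r f) r‖ ≤ N * r ^ (α - 1))
    (z : UnitAddTorus (Fin n)) {s : ℝ} (hs : 0 < s) :
    ‖translation Θ z (poisson Θ s f) - poisson Θ s f‖ ≤
      gradConst n * 2 ^ (2 - α) / (1 - α) * torusAbs z * N * s ^ (α - 1) := by
  have hB : gradConst n * 2 ^ (2 - α) / (1 - α) * torusAbs z * N * s ^ (α - 1) =
      ∫ r in Ioi s, gradConst n * 2 ^ (2 - α) * torusAbs z * N * r ^ (α - 2) := by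
    rw [integral_const_mul, integral_Ioi_rpow_of_lt (by linarith) hs,
      show α - 2 + 1 = -(1 - α) by ring, show α - 1 = -(1 - α) by ring, neg_div_neg_eq]
    ring
  rw [hB]
  refine norm_le_integral_of_coef_eq Θ
    (F := fun r => -(translation Θ z (deriv (fun r => poisson Θ r f) r) -
      deriv (fun r => poisson Θ r f) r))
    ((integrableOn_Ioi_rpow_of_lt (by linarith) hs).const_mul _) ?_ ?_ ?_
  · filter_upwards [ae_restrict_mem measurableSet_Ioi] with r hr
    have hr : 0 < r := hs.trans hr
    rw [norm_neg, deriv_poisson_eq_poisson_half Θ f hr]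
    refine (norm_translation_poisson_sub_le Θ z _ (half_pos hr)).trans ?_
    have hA := torusAbs_nonneg z
    have hG := gradConst_nonneg n
    calc _ ≤ gradConst n * torusAbs z * (r / 2)⁻¹ * (N * (r / 2) ^ (α - 1)) :=
          mul_le_mul_of_nonneg_left (hf _ (half_pos hr)) (by positivity)
      _ = gradConst n * torusAbs z * N * (r / 2) ^ (α - 2) := by
          rw [show α - 2 = α - 1 - 1 by ring, Real.rpow_sub_one (half_pos hr).ne' (α - 1)]
          ring
      _ = _ := by
          -- Halving the time is the origin of the factor `2 ^ (2 - α)`.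
          rw [Real.div_rpow hr.le two_pos.le, show (2 : ℝ) - α = -(α - 2) by ring,
            Real.rpow_neg two_pos.le]
          ring
  · intro l k
    simp only [map_neg, map_sub, coef_translation]
    have h := ((continuousOn_coef_deriv_poisson Θ f l k).mono
      (Ioi_subset_Ioi hs.le)).aestronglyMeasurable (μ := volume) measurableSet_Ioi
    exact ((h.const_mul _).sub h).neg
  · intro l k
    have h1 : ∫ r in Ioi s, coef Θ l k (-(translation Θ z (deriv (fun r => poisson Θ r f) r) -
        deriv (fun r => poisson Θ r f) r)) =
        ∫ r in Ioi s, ((-√(laplaceEig (l - k)) * Real.exp (-r * √(laplaceEig (l - k))) : ℝ) : ℂ) *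
          ((1 - mFourier (l - k) z) * coef Θ l k f) := by
      refine setIntegral_congr_fun measurableSet_Ioi fun r hr => ?_
      rw [map_neg, map_sub, coef_translation, coef_deriv_poisson Θ (hs.trans hr)]
      ring
    rw [h1, integral_mul_const, integral_complex_ofReal, map_sub, coef_translation,
      coef_poisson Θ hs]
    -- At frequency zero the Poisson multiplier does not decay, but the increment under translation
    -- vanishes.
    by_cases hk : l - k = 0
    · rw [hk, UnitAddTorus.mFourier_zero]
      simp
    · rw [integral_exp_neg_mul_Ioi (Real.sqrt_pos.2 (laplaceEig_pos hk))]
      push_cast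
      ring

/-- The constant in the estimate of translations by the semigroup Hölder seminorm. -/
noncomputable def translationConst (n : ℕ) (α : ℝ) : ℝ :=
  gradConst n * 2 ^ (2 - α) / (1 - α) + 2 / α

theorem norm_translation_sub_le (Θ : Matrix (Fin n) (Fin n) ℝ) {α N : ℝ} (hα₀ : 0 < α)
    (hα₁ : α < 1) {f : QT Θ}
    (hf : ∀ r, 0 < r → ‖deriv (fun r => poisson Θ r f) r‖ ≤ N * r ^ (α - 1))
    {z : UnitAddTorus (Fin n)} (hz : 0 < torusAbs z) :
    ‖translation Θ z f - f‖ ≤ translationConst n α * N * torusAbs z ^ α := by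
  -- The Poisson time is taken equal to `|z|`, so that `|z| s^{α-1}` and `s^α` agree.
  set s := torusAbs z with hs
  have h1 := norm_translation_poisson_sub_le_of_deriv Θ hα₁ hf z hz
  have h2 := norm_sub_poisson_le Θ hα₀ hf hz
  have h3 := norm_translation_le Θ z (f - poisson Θ s f)
  rw [← hs] at h1
  have h4 : translation Θ z f - f = (translation Θ z (poisson Θ s f) - poisson Θ s f) +
      (translation Θ z (f - poisson Θ s f) - (f - poisson Θ s f)) := by
    rw [map_sub]
    abel
  rw [h4]
  calc _ ≤ _ := (norm_add_le _ _).trans (add_le_add h1 (norm_sub_le _ _))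
    _ ≤ gradConst n * 2 ^ (2 - α) / (1 - α) * s * N * s ^ (α - 1) +
        (N * (s ^ α / α) + N * (s ^ α / α)) := by linarith
    _ = _ := by
        rw [translationConst, Real.rpow_sub_one hz.ne']
        field_simp
        ring

lemma torusAbs_pos {z : UnitAddTorus (Fin n)} (hz : z ≠ 0) : 0 < torusAbs z := by
  obtain ⟨i, hi⟩ := Function.ne_iff.mp hz
  exact (norm_pos_iff.2 hi).trans_le (norm_apply_le_torusAbs z i)

lemma enorm_le_ofReal_iff {E : Type*} [SeminormedAddCommGroup E] (x : E) {c : ℝ} (hc : 0 ≤ c) :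
    ‖x‖ₑ ≤ ENNReal.ofReal c ↔ ‖x‖ ≤ c := by
  rw [← ofReal_norm, ENNReal.ofReal_le_ofReal_iff hc]

theorem semigroupNorm_le (Θ : Matrix (Fin n) (Fin n) ℝ) {α : ℝ} (hα₀ : 0 < α) (hα₁ : α < 1)
    (f : QT Θ) :
    semigroupNorm Θ α f ≤ (max 1 (derivConst n α).toNNReal : ℝ≥0) * weaverNorm Θ α f := by
  -- If the right-hand norm is infinite, so is the product, the constant being at least 1; otherwise
  -- the estimate can be made with real numbers. The same bound by 1 takes care of the operator norm
  -- inside the maximum.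
  by_cases htop : weaverNorm Θ α f = ∞
  · rw [htop, ENNReal.mul_top]
    · exact le_top
    · exact_mod_cast (lt_max_of_lt_left one_pos).ne'
  set M := (weaverNorm Θ α f).toReal with hMdef
  have hM : weaverNorm Θ α f = ENNReal.ofReal M := (ENNReal.ofReal_toReal htop).symm
  have hM0 : 0 ≤ M := ENNReal.toReal_nonneg
  have hf : ∀ z, ‖translation Θ z f - f‖ ≤ M * torusAbs z ^ α := by
    intro z
    by_cases hz : z = 0
    · rw [hz, translation_zero, sub_self, norm_zero]
      exact mul_nonneg hM0 (Real.rpow_nonneg (torusAbs_nonneg _) _)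
    have hpos := Real.rpow_pos_of_pos (torusAbs_pos hz) α
    have h := (le_max_right _ _).trans' (le_iSup₂ (f := fun z (_ : z ≠ 0) =>
      ‖translation Θ z f - f‖ₑ / ENNReal.ofReal (torusAbs z ^ α)) z hz) |>.trans hM.le
    rw [ENNReal.div_le_iff (ENNReal.ofReal_pos.2 hpos).ne' ENNReal.ofReal_ne_top,
      ← ENNReal.ofReal_mul hM0, enorm_le_ofReal_iff _ (by positivity)] at h
    exact h
  refine max_le ?_ (iSup₂_le fun s hs => ?_)
  · refine (le_max_left _ _).trans (le_mul_of_one_le_left (zero_le (a := weaverNorm Θ α f)) ?_)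
    exact_mod_cast le_max_left _ _
  · have h := norm_deriv_poisson_le Θ hα₀ hα₁ hM0 hf hs
    have hpos : 0 < s ^ (1 - α) := Real.rpow_pos_of_pos hs _
    have h1 : ‖s ^ (1 - α) • deriv (fun r => poisson Θ r f) s‖ ≤ derivConst n α * M := by
      rw [norm_smul, Real.norm_of_nonneg hpos.le]
      calc _ ≤ s ^ (1 - α) * (derivConst n α * M * s ^ (α - 1)) := by gcongr
        _ = derivConst n α * M * (s ^ (1 - α) * s ^ (α - 1)) := by ring
        _ = _ := by rw [← Real.rpow_add hs, show 1 - α + (α - 1) = 0 by ring, Real.rpow_zero,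
            mul_one]
    have h2 : ‖s ^ (1 - α) • deriv (fun r => poisson Θ r f) s‖ₑ ≤
        ENNReal.ofReal (derivConst n α * M) :=
      (enorm_le_ofReal_iff _ ((norm_nonneg _).trans h1)).2 h1
    rw [ENNReal.ofReal_mul' hM0, ← hM] at h2
    refine h2.trans (mul_le_mul_left ?_ _)
    exact ENNReal.coe_le_coe.2 (le_max_right _ _)

theorem weaverNorm_le (Θ : Matrix (Fin n) (Fin n) ℝ) {α : ℝ} (hα₀ : 0 < α) (hα₁ : α < 1)
    (f : QT Θ) :
    weaverNorm Θ α f ≤ (max 1 (translationConst n α).toNNReal : ℝ≥0) * semigroupNorm Θ α f := by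
  by_cases htop : semigroupNorm Θ α f = ∞
  · rw [htop, ENNReal.mul_top]
    · exact le_top
    · exact_mod_cast (lt_max_of_lt_left one_pos).ne'
  set N := (semigroupNorm Θ α f).toReal with hNdef
  have hN : semigroupNorm Θ α f = ENNReal.ofReal N := (ENNReal.ofReal_toReal htop).symm
  have hN0 : 0 ≤ N := ENNReal.toReal_nonneg
  have hf : ∀ r, 0 < r → ‖deriv (fun r => poisson Θ r f) r‖ ≤ N * r ^ (α - 1) := by
    intro r hr
    have h := (le_max_right _ _).trans' (le_iSup₂ (f := fun s (_ : 0 < s) =>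
      ‖s ^ (1 - α) • deriv (fun r => poisson Θ r f) s‖ₑ) r hr) |>.trans hN.le
    have hpos : 0 < r ^ (1 - α) := Real.rpow_pos_of_pos hr _
    rw [enorm_le_ofReal_iff _ hN0, norm_smul, Real.norm_of_nonneg hpos.le] at h
    rw [show α - 1 = -(1 - α) by ring, Real.rpow_neg hr.le, ← div_eq_mul_inv, le_div_iff₀ hpos]
    linarith
  refine max_le ?_ (iSup₂_le fun z hz => ?_)
  · refine (le_max_left _ _).trans (le_mul_of_one_le_left (zero_le (a := semigroupNorm Θ α f)) ?_)
    exact_mod_cast le_max_left _ _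
  · have h := norm_translation_sub_le Θ hα₀ hα₁ hf (torusAbs_pos hz)
    have hpos := Real.rpow_pos_of_pos (torusAbs_pos hz) α
    have h2 := (enorm_le_ofReal_iff _ ((norm_nonneg _).trans h)).2 h
    rw [ENNReal.ofReal_mul' hpos.le, ENNReal.ofReal_mul' hN0, ← hN] at h2
    refine ENNReal.div_le_of_le_mul (h2.trans (mul_le_mul_left (mul_le_mul_left ?_ _) _))
    exact ENNReal.coe_le_coe.2 (le_max_right _ _)

end HoelderEstimates

end QTorus

/-! ### Equivalence of the two norms -/

theorem mainTheorem7 (n : ℕ) (α : ℝ) (hα₀ : 0 < α) (hα₁ : α < 1) :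
    ∃ C : ℝ≥0, 0 < C ∧
      ∀ Θ : Matrix (Fin n) (Fin n) ℝ, Θ.transpose = -Θ →
        (∀ f : QTorus.QT Θ,
          QTorus.semigroupNorm Θ α f ≤ C * QTorus.weaverNorm Θ α f ∧
          QTorus.weaverNorm Θ α f ≤ C * QTorus.semigroupNorm Θ α f) ∧
        ∃ e : QTorus.SemigroupHoelder Θ α ≃ₗ[ℂ] QTorus.WeaverHoelder Θ α,
          ∀ f : QTorus.SemigroupHoelder Θ α,
            ((e f : QTorus.QT Θ) = (f : QTorus.QT Θ)) ∧
            QTorus.semigroupNorm Θ α f ≤ C * QTorus.weaverNorm Θ α (e f) ∧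
            QTorus.weaverNorm Θ α (e f) ≤ C * QTorus.semigroupNorm Θ α f := by
  set C₁ : ℝ≥0 := max 1 (QTorus.derivConst n α).toNNReal
  set C₂ : ℝ≥0 := max 1 (QTorus.translationConst n α).toNNReal
  refine ⟨max C₁ C₂, lt_max_of_lt_left (lt_max_of_lt_left one_pos), fun Θ _ => ?_⟩
  have key : ∀ f : QTorus.QT Θ,
      QTorus.semigroupNorm Θ α f ≤ (max C₁ C₂ : ℝ≥0) * QTorus.weaverNorm Θ α f ∧
      QTorus.weaverNorm Θ α f ≤ (max C₁ C₂ : ℝ≥0) * QTorus.semigroupNorm Θ α f := fun f =>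
    ⟨(QTorus.semigroupNorm_le Θ hα₀ hα₁ f).trans
      (mul_le_mul_left (ENNReal.coe_le_coe.2 (le_max_left _ _)) _),
    (QTorus.weaverNorm_le Θ hα₀ hα₁ f).trans
      (mul_le_mul_left (ENNReal.coe_le_coe.2 (le_max_right _ _)) _)⟩
  -- Each space is the finiteness set of its norm, so the two-sided estimate with finite constant
  -- makes them equal, and the isomorphism is the identity.
  have heq : QTorus.SemigroupHoelder Θ α = QTorus.WeaverHoelder Θ α := by
    ext f
    exact ⟨fun hf => (key f).2.trans_lt (ENNReal.mul_lt_top ENNReal.coe_lt_top hf),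
      fun hf => (key f).1.trans_lt (ENNReal.mul_lt_top ENNReal.coe_lt_top hf)⟩
  exact ⟨key, LinearEquiv.ofEq _ _ heq, fun f => ⟨rfl, key f⟩⟩
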